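/- A basic sequence is a sequence $Q=(q_n)_{n\ge1}$ of integers $q_n\ge2$. Every real $x$ has a unique $Q$-Cantor series expansion $x=\lfloor x\rfloor+\sum_{n\ge1}\frac{E_n}{q_1q_2\cdots q_n}$ with $E_n\in\{0,1,\dots,q_n-1\}$ and $E_n\ne q_n-1$ for infinitely many $n$. For $k\ge1$ put $Q_n^{(k)}=\sum_{j=1}^n\frac1{q_jq_{j+1}\cdots q_{j+k-1}}$, and for a block $B$, i.e. a $k$-tuple of non-negative integers, let $N_n^Q(B,x)$ be the number of positions $j\le n$ with $(E_j,\dots,E_{j+k-1})=B$. The number $x$ is $Q$-normal of order $k$ if $\lim_{n\to\infty}N_n^Q(B,x)/Q_n^{(k)}=1$ for all blocks $B$ of length $k$; let $\mathscr N_k(Q)$ be the set of these numbers. $Q$ is infinite in limit if $q_n\to\infty$, and fully divergent if $\lim_{n\to\infty}Q_n^{(k)}=\infty$ for every $k\ge1$. Let $\alpha=(\alpha_i)_{i\ge1}$ and $\beta=(\beta_i)_{i\ge1}$ be basic sequences, let $s=(s_i)_{i\ge1}$, $t=(t_i)_{i\ge1}$, $\upsilon=(\upsilon_i)_{i\ge1}$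 be sequences of non-negative integers, and let $Q=Q(\alpha,\beta,s,t,\upsilon)$ be the sequence $$\left[[\alpha_1]^{s_1}[\beta_1]^{t_1}\right]^{\upsilon_1}\left[[\alpha_2]^{s_2}[\beta_2]^{t_2}\right]^{\upsilon_2}\left[[\alpha_3]^{s_3}[\beta_3]^{t_3}\right]^{\upsilon_3}\cdots,$$ where $[w]^m$ denotes $m$ consecutive copies of $w$. Let $\ell\ge1$ be an integer. Theorem. Suppose that $Q$ is infinite in limit and fully divergent, and that (all quotients below being defined for all sufficiently large $n$) (HDT1) $\displaystyle\lim_{n\to\infty}\frac{s_n\log\alpha_n}{\sum_{i=1}^{n-1}\upsilon_it_i\log\beta_i}=0$; (HDT2) $\displaystyle\lim_{n\to\infty}\frac{s_n\log\alpha_n}{t_n\log\beta_n}=0$; (NQ) $\displaystyle\lim_{n\to\infty}\frac{t_n\alpha_n^k}{s_n\beta_n^k}=0$ for every $k\ge\ell$; (NotNQ) $\displaystyle\lim_{n\to\infty}\frac{t_n\alpha_n^k}{s_n\beta_n^k}$ exists in $(0,\infty]$ for every $1\le k<\ell$; (RNQ) $\displaystyle\lim_{n\to\infty}\frac{\alpha_n^k}{s_n}=0$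 for every $k\ge1$. Then $$\dim_H\Big(\bigcap_{j=\ell}^\infty\mathscr N_j(Q)\;\Big\backslash\;\bigcup_{j=1}^{\ell-1}\mathscr N_j(Q)\Big)=1 .$$ -/

import Mathlib

open Filter Topology

/-! All sequences are indexed from `0`: the Lean term `q n` is the mathematical term `q_{n+1}`. -/

namespace CantorSeries

/-- A basic sequence: a sequence of integers that are at least `2`. -/
def IsBasic (q : ℕ → ℕ) : Prop := ∀ n, 2 ≤ q n

/-- `E` is the digit sequence `E_1, E_2, …` of the `q`-Cantor series expansion of `x`
(the digit `E_0` is `⌊x⌋`): `E_n ∈ {0, …, q_n - 1}`, `E_n ≠ q_n - 1` infinitely often, and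
`x = ⌊x⌋ + ∑ E_n / (q_1 ⋯ q_n)`. -/
def IsExpansion (q : ℕ → ℕ) (x : ℝ) (E : ℕ → ℕ) : Prop :=
  (∀ n, E n < q n) ∧ (∃ᶠ n in atTop, E n + 1 ≠ q n) ∧
    HasSum (fun n => (E n : ℝ) / ∏ i ∈ Finset.range (n + 1), (q i : ℝ)) (x - (⌊x⌋ : ℝ))

/-- The number of occurrences of the block `B` in the digit sequence `E` that start at one of
the first `n` positions. -/
def blockCount {k : ℕ} (E : ℕ → ℕ) (B : Fin k → ℕ) (n : ℕ) : ℕ :=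
  ((Finset.range n).filter (fun j => ∀ i : Fin k, E (j + i) = B i)).card

/-- `Q_n^{(k)} = ∑_{j=1}^n 1 / (q_j q_{j+1} ⋯ q_{j+k-1})`. -/
noncomputable def expectedCount (q : ℕ → ℕ) (k n : ℕ) : ℝ :=
  ∑ j ∈ Finset.range n, 1 / ∏ i ∈ Finset.range k, (q (j + i) : ℝ)

/-- The set of real numbers that are `q`-normal of order `k`. -/
def normalOfOrder (q : ℕ → ℕ) (k : ℕ) : Set ℝ :=
  {x | ∃ E : ℕ → ℕ, IsExpansion q x E ∧ ∀ B : Fin k → ℕ,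
    Tendsto (fun n => (blockCount E B n : ℝ) / expectedCount q k n) atTop (𝓝 1)}

/-- `q_n → ∞`. -/
def InfiniteInLimit (q : ℕ → ℕ) : Prop := Tendsto q atTop atTop

/-- `Q_n^{(k)} → ∞` for every `k ≥ 1`. -/
def FullyDivergent (q : ℕ → ℕ) : Prop :=
  ∀ k, 1 ≤ k → Tendsto (expectedCount q k) atTop atTop

/-- The number of terms of `[[α_1]^{s_1}[β_1]^{t_1}]^{υ_1} [[α_2]^{s_2}[β_2]^{t_2}]^{υ_2} ⋯` that
precede the part with (zero-based) index `i`. -/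
def partStart (s t υ : ℕ → ℕ) (i : ℕ) : ℕ :=
  ∑ j ∈ Finset.range i, υ j * (s j + t j)

/-- The index of the part that contains the position `n`. -/
noncomputable def partIndex (s t υ : ℕ → ℕ) (n : ℕ) : ℕ :=
  sInf {i | n < partStart s t υ (i + 1)}

/-- The sequence `Q(α, β, s, t, υ)`, that is
`[[α_1]^{s_1}[β_1]^{t_1}]^{υ_1} [[α_2]^{s_2}[β_2]^{t_2}]^{υ_2} ⋯`, where `[a]^m` is `m` copies of `a`,
and `[w]^m` is `m` copies of the word `w`. -/
noncomputable def blockSeq (α β s t υ : ℕ → ℕ) (n : ℕ) : ℕ :=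
  if (n - partStart s t υ (partIndex s t υ n)) %
      (s (partIndex s t υ n) + t (partIndex s t υ n)) < s (partIndex s t υ n)
  then α (partIndex s t υ n) else β (partIndex s t υ n)

/-- The term at place `d` of the copy with index `c` of `[α_i]^{s_i}[β_i]^{t_i}` is `α_i` for
`d < s_i` and `β_i` otherwise. -/
theorem blockSeq_apply (α β s t υ : ℕ → ℕ) {i c d : ℕ} (hc : c < υ i) (hd : d < s i + t i) :
    blockSeq α β s t υ (partStart s t υ i + c * (s i + t i) + d) =
      if d < s i then α i else β i := by
  have hmono : Monotone (partStart s t υ) := fun a b hab =>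
    Finset.sum_le_sum_of_subset (Finset.range_mono hab)
  have hlt : partStart s t υ i + c * (s i + t i) + d < partStart s t υ (i + 1) := by
    have h1 : partStart s t υ (i + 1) = partStart s t υ i + υ i * (s i + t i) :=
      Finset.sum_range_succ _ _
    have h2 : (c + 1) * (s i + t i) ≤ υ i * (s i + t i) := Nat.mul_le_mul_right _ hc
    rw [h1]
    linarith
  have hidx : partIndex s t υ (partStart s t υ i + c * (s i + t i) + d) = i := by
    apply le_antisymm
    · exact Nat.sInf_le hlt
    · refine le_csInf ⟨i, hlt⟩ fun j hj => ?_
      by_contra hji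
      have h3 : partStart s t υ (j + 1) ≤ partStart s t υ i := hmono (by omega)
      have h4 : partStart s t υ i + c * (s i + t i) + d < partStart s t υ (j + 1) := hj
      have h5 := Nat.zero_le (c * (s i + t i))
      omega
  unfold blockSeq
  rw [hidx, add_assoc, Nat.add_sub_cancel_left, Nat.add_comm (c * _) d, Nat.add_mul_mod_self_right,
    Nat.mod_eq_of_lt hd]

/-- `lim s_n log α_n / ∑_{i=1}^{n-1} υ_i t_i log β_i = 0`, the quotient being defined
for all large `n`. -/
def HDT1 (α β s t υ : ℕ → ℕ) : Prop :=
  (∀ᶠ n in atTop, ∑ i ∈ Finset.range n, (υ i : ℝ) * t i * Real.log (β i) ≠ 0) ∧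
  Tendsto (fun n => (s n : ℝ) * Real.log (α n) /
    ∑ i ∈ Finset.range n, (υ i : ℝ) * t i * Real.log (β i)) atTop (𝓝 0)

/-- `lim s_n log α_n / (t_n log β_n) = 0`, the quotient being defined for all large `n`. -/
def HDT2 (α β s t : ℕ → ℕ) : Prop :=
  (∀ᶠ n in atTop, (t n : ℝ) * Real.log (β n) ≠ 0) ∧
  Tendsto (fun n => (s n : ℝ) * Real.log (α n) / ((t n : ℝ) * Real.log (β n))) atTop (𝓝 0)

/-- `lim t_n α_n^k / (s_n β_n^k) = 0`, the quotient being defined for all large `n`. -/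
def NQ (α β s t : ℕ → ℕ) (k : ℕ) : Prop :=
  (∀ᶠ n in atTop, (s n : ℝ) * (β n : ℝ) ^ k ≠ 0) ∧
  Tendsto (fun n => (t n : ℝ) * (α n : ℝ) ^ k / ((s n : ℝ) * (β n : ℝ) ^ k)) atTop (𝓝 0)

/-- `lim t_n α_n^k / (s_n β_n^k)` exists and is positive, possibly `+∞`, the quotient being
defined for all large `n`. -/
def NotNQ (α β s t : ℕ → ℕ) (k : ℕ) : Prop :=
  (∀ᶠ n in atTop, (s n : ℝ) * (β n : ℝ) ^ k ≠ 0) ∧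
  ∃ L : EReal, 0 < L ∧
    Tendsto (fun n => (((t n : ℝ) * (α n : ℝ) ^ k / ((s n : ℝ) * (β n : ℝ) ^ k) : ℝ) : EReal))
      atTop (𝓝 L)

/-- `lim α_n^k / s_n = 0`, the quotient being defined for all large `n`. -/
def RNQ (α s : ℕ → ℕ) (k : ℕ) : Prop :=
  (∀ᶠ n in atTop, (s n : ℝ) ≠ 0) ∧
  Tendsto (fun n => (α n : ℝ) ^ k / (s n : ℝ)) atTop (𝓝 0)

end CantorSeries

namespace CantorSeries

/-! Choose the digits independently: uniform on `{0, …, α_i - 1}` in the runs of `α_i`, uniform on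
`{β_i / 2, …, β_i - 1}` in the runs of `β_i`. The digits in the `β`-runs tend to infinity, so far
out a fixed block `B` can occur only in windows lying inside an `α`-run, and there it has its full
probability `1 / (q_j ⋯ q_{j+k-1})`. Block events at disjoint windows are independent, so a second
moment argument shows that almost surely the count of every `B` is asymptotic to the sum of these
free weights (`ae_tendsto_blockCount_div`).

One copy of `[α_i]^{s_i}[β_i]^{t_i}` has free weight about `s_i / α_i^k` and lost weight about `t_i
/ β_i^k`, up to a bounded number of boundary windows, negligible by (RNQ). By (NQ) the loss is
negligible for `k ≥ ℓ`, which gives normality (`tendsto_sum_freeWeight_div`); by (NotNQ) it is a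
fixed proportion for `k < ℓ`, which destroys it (`not_tendsto_sum_freeWeight_div`).

The restriction removes at most half of the choices at each place, so a cylinder of level `n` has
mass at most `2^n / (q_1 ⋯ q_n)`. As `q_n → ∞`, the factor `2^n` is smaller than any positive power
of `q_1 ⋯ q_n` up to a constant, and the mass distribution principle gives dimension `1`
(`one_le_dimH`). -/

/-- The integer with mixed radix digits `E 0, …, E (n - 1)` in the bases `q 0, …, q (n - 1)`. -/
def prefixNum (q E : ℕ → ℕ) : ℕ → ℕ
  | 0 => 0
  | n + 1 => prefixNum q E n * q n + E n

/-- The product `q 0 * ⋯ * q (n - 1)`. -/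
noncomputable def denom (q : ℕ → ℕ) (n : ℕ) : ℝ := ∏ i ∈ Finset.range n, (q i : ℝ)

/-! ### Cylinders of the Cantor series expansion and uniqueness of digits -/

section Expansion

variable {q E : ℕ → ℕ} {y : ℝ}

theorem denom_succ (q : ℕ → ℕ) (n : ℕ) : denom q (n + 1) = denom q n * q n :=
  Finset.prod_range_succ _ _

theorem denom_pos (hq : ∀ n, 0 < q n) (n : ℕ) : 0 < denom q n :=
  Finset.prod_pos fun i _ => Nat.cast_pos.mpr (hq i)

theorem sum_range_eq_prefixNum_div (hq : ∀ n, 0 < q n) (E : ℕ → ℕ) (n : ℕ) :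
    ∑ i ∈ Finset.range n, (E i : ℝ) / denom q (i + 1) = prefixNum q E n / denom q n := by
  induction n with
  | zero => simp [prefixNum]
  | succ n ih =>
    have h1 := (denom_pos hq n).ne'
    have h2 : (q n : ℝ) ≠ 0 := Nat.cast_ne_zero.mpr (hq n).ne'
    rw [Finset.sum_range_succ, ih, denom_succ, prefixNum]
    push_cast
    field_simp

/-- The two sides are the right endpoints of nested cylinders; `E n + 1 ≤ q n` keeps the smaller one
inside. -/
theorem prefixNum_succ_add_one_div_le (hE : ∀ n, E n < q n) (n : ℕ) :
    ((prefixNum q E (n + 1) : ℝ) + 1) / denom q (n + 1) ≤ (prefixNum q E n + 1) / denom q n := by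
  have hq : ∀ n, 0 < q n := fun n => (Nat.zero_le _).trans_lt (hE n)
  have h0 := denom_pos hq n
  have h2 : (0 : ℝ) < q n := Nat.cast_pos.mpr (hq n)
  have h3 : (E n : ℝ) + 1 ≤ q n := by exact_mod_cast hE n
  rw [denom_succ, prefixNum, div_le_div_iff₀ (by positivity) h0]
  push_cast
  nlinarith

theorem prefixNum_succ_add_one_div_lt (hE : ∀ n, E n < q n) {n : ℕ} (hn : E n + 1 ≠ q n) :
    ((prefixNum q E (n + 1) : ℝ) + 1) / denom q (n + 1) < (prefixNum q E n + 1) / denom q n := by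
  have hq : ∀ n, 0 < q n := fun n => (Nat.zero_le _).trans_lt (hE n)
  have h0 := denom_pos hq n
  have h2 : (0 : ℝ) < q n := Nat.cast_pos.mpr (hq n)
  have h3 : (E n : ℝ) + 1 < q n := by exact_mod_cast lt_of_le_of_ne (hE n) hn
  rw [denom_succ, prefixNum, div_lt_div_iff₀ (by positivity) h0]
  push_cast
  nlinarith

theorem antitone_prefixNum_add_one_div (hE : ∀ n, E n < q n) :
    Antitone fun n => ((prefixNum q E n : ℝ) + 1) / denom q n :=
  antitone_nat_of_succ_le (prefixNum_succ_add_one_div_le hE)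

theorem summable_digits (hE : ∀ n, E n < q n) :
    Summable fun n => (E n : ℝ) / denom q (n + 1) := by
  have hq : ∀ n, 0 < q n := fun n => (Nat.zero_le _).trans_lt (hE n)
  refine summable_of_sum_range_le (c := 1)
    (fun n => div_nonneg (Nat.cast_nonneg _) (denom_pos hq _).le) fun n => ?_
  rw [sum_range_eq_prefixNum_div hq]
  have h := antitone_prefixNum_add_one_div hE (Nat.zero_le n)
  simp only [prefixNum, denom, Finset.range_zero, Finset.prod_empty] at h
  refine le_trans ?_ (h.trans (by simp))
  exact div_le_div_of_nonneg_right (by linarith) (denom_pos hq n).le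

theorem prefixNum_le (hE : ∀ n, E n < q n)
    (hy : HasSum (fun n => (E n : ℝ) / denom q (n + 1)) y) (n : ℕ) :
    (prefixNum q E n : ℝ) ≤ y * denom q n := by
  have hq : ∀ n, 0 < q n := fun n => (Nat.zero_le _).trans_lt (hE n)
  rw [← div_le_iff₀ (denom_pos hq n), ← sum_range_eq_prefixNum_div hq]
  exact sum_le_hasSum _ (fun i _ => div_nonneg (Nat.cast_nonneg _) (denom_pos hq _).le) hy

theorem le_prefixNum_add_one (hE : ∀ n, E n < q n)
    (hy : HasSum (fun n => (E n : ℝ) / denom q (n + 1)) y) (n : ℕ) :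
    y * denom q n ≤ prefixNum q E n + 1 := by
  have hq : ∀ n, 0 < q n := fun n => (Nat.zero_le _).trans_lt (hE n)
  rw [← le_div_iff₀ (denom_pos hq n)]
  refine le_of_tendsto hy.tendsto_sum_nat (eventually_atTop.mpr ⟨n, fun m hm => ?_⟩)
  rw [sum_range_eq_prefixNum_div hq]
  refine le_trans ?_ (antitone_prefixNum_add_one_div hE hm)
  exact div_le_div_of_nonneg_right (by linarith) (denom_pos hq m).le

theorem lt_prefixNum_add_one (hE : ∀ n, E n < q n) (hf : ∃ᶠ n in atTop, E n + 1 ≠ q n)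
    (hy : HasSum (fun n => (E n : ℝ) / denom q (n + 1)) y) (n : ℕ) :
    y * denom q n < prefixNum q E n + 1 := by
  have hq : ∀ n, 0 < q n := fun n => (Nat.zero_le _).trans_lt (hE n)
  obtain ⟨m, hm, hne⟩ := frequently_atTop.mp hf n
  rw [← lt_div_iff₀ (denom_pos hq n)]
  have h1 := (le_div_iff₀ (denom_pos hq (m + 1))).mpr (le_prefixNum_add_one hE hy (m + 1))
  exact (h1.trans_lt (prefixNum_succ_add_one_div_lt hE hne)).trans_le
    (antitone_prefixNum_add_one_div hE hm)

/-- The prefixes can be read off from the number itself: a later non-maximal digit keeps `y`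
strictly below the right endpoint of each of its cylinders. -/
theorem floor_mul_denom (hE : ∀ n, E n < q n) (hf : ∃ᶠ n in atTop, E n + 1 ≠ q n)
    (hy : HasSum (fun n => (E n : ℝ) / denom q (n + 1)) y) (n : ℕ) :
    ⌊y * denom q n⌋ = (prefixNum q E n : ℤ) :=
  Int.floor_eq_iff.mpr ⟨by exact_mod_cast prefixNum_le hE hy n,
    by exact_mod_cast lt_prefixNum_add_one hE hf hy n⟩

theorem IsExpansion.unique {x : ℝ} {E F : ℕ → ℕ} (hE : IsExpansion q x E)
    (hF : IsExpansion q x F) : E = F := by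
  have h : ∀ n, prefixNum q E n = prefixNum q F n := fun n => by
    have h1 := floor_mul_denom hE.1 hE.2.1 hE.2.2 n
    rw [floor_mul_denom hF.1 hF.2.1 hF.2.2 n] at h1
    exact_mod_cast h1.symm
  funext n
  have h1 := h (n + 1)
  simp only [prefixNum, h n] at h1
  omega

theorem isExpansion_of_hasSum (hE : ∀ n, E n < q n) (hf : ∃ᶠ n in atTop, E n + 1 ≠ q n)
    (hy : HasSum (fun n => (E n : ℝ) / denom q (n + 1)) y) : IsExpansion q y E := by
  refine ⟨hE, hf, ?_⟩
  -- The empty prefix gives `⌊y⌋ = 0`.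
  have h := floor_mul_denom hE hf hy 0
  simp only [denom, prefixNum, Finset.range_zero, Finset.prod_empty, mul_one, Nat.cast_zero] at h
  rw [h]
  simpa [denom] using hy

theorem eq_of_prefixNum_eq {F : ℕ → ℕ} (hE : ∀ n, E n < q n) (hF : ∀ n, F n < q n) {n : ℕ}
    (h : prefixNum q E n = prefixNum q F n) : ∀ i < n, E i = F i := by
  induction n with
  | zero => simp
  | succ n ih =>
    simp only [prefixNum] at h
    have h1 : E n = F n := by
      have := congrArg (· % q n) h
      simpa [Nat.add_mod, Nat.mod_eq_of_lt (hE n), Nat.mod_eq_of_lt (hF n)] using this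
    have h2 : prefixNum q E n = prefixNum q F n := by
      rw [h1] at h
      exact Nat.eq_of_mul_eq_mul_right ((Nat.zero_le _).trans_lt (hE n)) (Nat.add_right_cancel h)
    intro i hi
    rcases Nat.lt_succ_iff_lt_or_eq.mp hi with hi | rfl
    · exact ih h2 i hi
    · exact h1

end Expansion

/-! ### A strong law for events with finite range of dependence -/

section FiniteRangeDependence

open MeasureTheory

variable {Ω : Type*} [MeasurableSpace Ω] {μ : Measure Ω} [IsProbabilityMeasure μ]
  {S : ℕ → Set Ω} {k : ℕ}

theorem integral_indicator_sub_mul (hS : ∀ j, MeasurableSet (S j)) (i j : ℕ) :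
    ∫ ω, ((S i).indicator (1 : Ω → ℝ) ω - μ.real (S i)) *
      ((S j).indicator (1 : Ω → ℝ) ω - μ.real (S j)) ∂μ =
      μ.real (S i ∩ S j) - μ.real (S i) * μ.real (S j) := by
  have hint : ∀ {T : Set Ω}, MeasurableSet T → Integrable (T.indicator (1 : Ω → ℝ)) μ :=
    fun hT => (integrable_const (1 : ℝ)).indicator hT
  have h : ∀ ω, ((S i).indicator (1 : Ω → ℝ) ω - μ.real (S i)) *
      ((S j).indicator (1 : Ω → ℝ) ω - μ.real (S j)) =
      (S i ∩ S j).indicator (1 : Ω → ℝ) ω - μ.real (S j) * (S i).indicator (1 : Ω → ℝ) ω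
        - μ.real (S i) * (S j).indicator (1 : Ω → ℝ) ω + μ.real (S i) * μ.real (S j) := by
    intro ω
    rw [Set.inter_indicator_one, Pi.mul_apply]
    ring
  have hi := (hint (hS i)).const_mul (μ.real (S j))
  have hj := (hint (hS j)).const_mul (μ.real (S i))
  have hij := hint ((hS i).inter (hS j))
  simp_rw [h]
  rw [integral_add (by exact (hij.sub hi).sub hj) (integrable_const _),
    integral_sub (by exact hij.sub hi) hj, integral_sub hij hi, integral_const_mul,
    integral_const_mul, integral_indicator_one ((hS i).inter (hS j)),
    integral_indicator_one (hS i), integral_indicator_one (hS j), integral_const]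
  simp
  ring

theorem integrable_indicator_sub_mul (hS : ∀ j, MeasurableSet (S j)) (i j : ℕ) :
    Integrable (fun ω => ((S i).indicator (1 : Ω → ℝ) ω - μ.real (S i)) *
      ((S j).indicator (1 : Ω → ℝ) ω - μ.real (S j))) μ := by
  have hint : ∀ {T : Set Ω}, MeasurableSet T → Integrable (T.indicator (1 : Ω → ℝ)) μ :=
    fun hT => (integrable_const (1 : ℝ)).indicator hT
  have hb : ∀ i ω, |(S i).indicator (1 : Ω → ℝ) ω - μ.real (S i)| ≤ 1 := fun i ω => by
    have h1 : μ.real (S i) ≤ 1 := measureReal_le_one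
    have h2 : 0 ≤ μ.real (S i) := measureReal_nonneg
    by_cases h : ω ∈ S i <;> simp [h, abs_le] <;> linarith
  refine ((hint (hS j)).sub (integrable_const _)).bdd_mul (c := 1)
    ((hint (hS i)).sub (integrable_const _)).aestronglyMeasurable (ae_of_all _ fun ω => ?_)
  simpa using hb i ω

theorem sq_sum_eq (f : ℕ → ℝ) (n : ℕ) : (∑ j ∈ Finset.range n, f j) ^ 2 =
    ∑ j ∈ Finset.range n, ∑ i ∈ Finset.range n, f i * f j := by
  rw [sq, Finset.sum_mul_sum, Finset.sum_comm]

theorem integrable_sq_sum_indicator_sub (hS : ∀ j, MeasurableSet (S j)) (n : ℕ) :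
    Integrable (fun ω => (∑ j ∈ Finset.range n,
      ((S j).indicator (1 : Ω → ℝ) ω - μ.real (S j))) ^ 2) μ := by
  simp_rw [sq_sum_eq]
  exact integrable_finsetSum _ fun j _ => integrable_finsetSum _ fun i _ =>
    integrable_indicator_sub_mul hS i j

/-- The variance of the number of occurrences of events with dependence range `k` is at most `2k`
times the mean. -/
theorem integral_sq_sum_indicator_sub_le (hS : ∀ j, MeasurableSet (S j))
    (hind : ∀ i j, i + k ≤ j → μ.real (S i ∩ S j) = μ.real (S i) * μ.real (S j)) (n : ℕ) :
    ∫ ω, (∑ j ∈ Finset.range n, ((S j).indicator (1 : Ω → ℝ) ω - μ.real (S j))) ^ 2 ∂μ ≤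
      2 * k * ∑ j ∈ Finset.range n, μ.real (S j) := by
  simp_rw [sq_sum_eq]
  rw [integral_finsetSum _ fun j _ => integrable_finsetSum _ fun i _ =>
    integrable_indicator_sub_mul hS i j, Finset.mul_sum]
  refine Finset.sum_le_sum fun j _ => ?_
  rw [integral_finsetSum _ fun i _ => integrable_indicator_sub_mul hS i j]
  have h0 : ∀ i, 0 ≤ μ.real (S i) := fun i => measureReal_nonneg
  -- Covariances vanish when the indices are at least `k` apart; each of the at most `2k` remaining
  -- ones is bounded by the probability of `S j`.
  calc _ ≤ ∑ i ∈ Finset.range n, if i ∈ Finset.Ico (j + 1 - k) (j + k) then μ.real (S j) else 0 := by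
        refine Finset.sum_le_sum fun i _ => ?_
        rw [integral_indicator_sub_mul hS]
        split_ifs with h
        · have h1 : μ.real (S i ∩ S j) ≤ μ.real (S j) := measureReal_mono Set.inter_subset_right
          nlinarith [h0 i, h0 j]
        · rw [Finset.mem_Ico] at h
          rcases le_or_gt (j + k) i with h' | h'
          · rw [Set.inter_comm, hind j i h']
            linarith
          · rw [hind i j (by omega)]
            linarith
    _ = ∑ i ∈ (Finset.range n) with i ∈ Finset.Ico (j + 1 - k) (j + k), μ.real (S j) :=
        (Finset.sum_filter _ _).symm
    _ ≤ ∑ i ∈ Finset.Ico (j + 1 - k) (j + k), μ.real (S j) :=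
        Finset.sum_le_sum_of_subset_of_nonneg (fun i hi => (Finset.mem_filter.mp hi).2)
          fun i _ _ => h0 j
    _ ≤ 2 * k * μ.real (S j) := by
        rw [Finset.sum_const, nsmul_eq_mul, Nat.card_Ico]
        refine mul_le_mul_of_nonneg_right ?_ (h0 j)
        have : j + k - (j + 1 - k) ≤ 2 * k := by omega
        exact_mod_cast this

/-- A ratio of monotone sequences tends to `1` if it does so along a sequence of indices at which
the denominator is close to the squares. -/
theorem tendsto_div_of_tendsto_subseq {u M : ℕ → ℝ} (hu : Monotone u) (hu0 : ∀ n, 0 ≤ u n)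
    {N : ℕ → ℕ} (hN : ∀ m n : ℕ, (m : ℝ) ^ 2 ≤ M n ↔ N m ≤ n)
    (hMtop : Tendsto M atTop atTop)
    (h : Tendsto (fun m => u (N m) / (m : ℝ) ^ 2) atTop (𝓝 1)) :
    Tendsto (fun n => u n / M n) atTop (𝓝 1) := by
  -- With `r² ≤ M n < (r + 1)²`, monotonicity traps `u n / M n` between values at `N r` and `N (r +
  -- 1)`, off by factors `(r / (r + 1))^{±2}` that tend to `1`.
  set r : ℕ → ℕ := fun n => Nat.sqrt ⌊M n⌋₊ with hr
  have hrtop : Tendsto r atTop atTop := by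
    have hs : Tendsto Nat.sqrt atTop atTop :=
      tendsto_atTop_atTop.mpr fun b => ⟨b * b, fun a ha => Nat.le_sqrt.mpr ha⟩
    exact hs.comp (tendsto_nat_floor_atTop.comp hMtop)
  have hlim : Tendsto (fun m : ℕ => (m : ℝ) / ((m : ℝ) + 1)) atTop (𝓝 1) :=
    tendsto_natCast_div_add_atTop (1 : ℝ)
  have hlow : Tendsto (fun m : ℕ => u (N m) / (m : ℝ) ^ 2 * ((m : ℝ) / (m + 1)) ^ 2)
      atTop (𝓝 1) := by simpa using h.mul (hlim.pow 2)
  have hup : Tendsto (fun m : ℕ => u (N (m + 1)) / ((m + 1 : ℕ) : ℝ) ^ 2 *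
      ((m : ℝ) / (m + 1))⁻¹ ^ 2) atTop (𝓝 1) := by
    simpa using ((tendsto_add_atTop_iff_nat 1).mpr h).mul ((hlim.inv₀ one_ne_zero).pow 2)
  refine tendsto_of_tendsto_of_tendsto_of_le_of_le' (hlow.comp hrtop) (hup.comp hrtop) ?_ ?_
  all_goals
    filter_upwards [hrtop.eventually_ge_atTop 1, hMtop.eventually_gt_atTop 0] with n hn hMn
    have hrn : (0 : ℝ) < r n := by exact_mod_cast hn
    have hle : (r n : ℝ) ^ 2 ≤ M n := by
      refine le_trans ?_ (Nat.floor_le hMn.le)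
      exact_mod_cast Nat.sqrt_le' ⌊M n⌋₊
    have hlt : M n < ((r n + 1 : ℕ) : ℝ) ^ 2 := by
      refine (Nat.lt_floor_add_one _).trans_le ?_
      exact_mod_cast Nat.lt_succ_sqrt' ⌊M n⌋₊
    simp only [Function.comp_apply]
  · have h1 : u (N (r n)) ≤ u n := hu ((hN _ _).mp hle)
    have h2 : u (N (r n)) / (r n : ℝ) ^ 2 * ((r n : ℝ) / (r n + 1)) ^ 2 =
        u (N (r n)) / ((r n + 1 : ℕ) : ℝ) ^ 2 := by
      push_cast
      field_simp
    rw [h2]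
    exact div_le_div₀ (hu0 _) h1 hMn hlt.le
  · have h1 : u n ≤ u (N (r n + 1)) := by
      refine hu (le_of_lt (lt_of_not_ge fun h' => ?_))
      exact not_le.mpr hlt ((hN (r n + 1) n).mpr h')
    have h2 : u (N (r n + 1)) / ((r n + 1 : ℕ) : ℝ) ^ 2 * ((r n : ℝ) / (r n + 1))⁻¹ ^ 2 =
        u (N (r n + 1)) / (r n : ℝ) ^ 2 := by
      push_cast
      field_simp
    rw [h2]
    exact div_le_div₀ (hu0 _) h1 (by positivity) hle

/-- The strong law for the number of occurrences of events with dependence range `k` and divergent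
sum of probabilities. -/
theorem ae_tendsto_sum_indicator_div (hS : ∀ j, MeasurableSet (S j))
    (hind : ∀ i j, i + k ≤ j → μ.real (S i ∩ S j) = μ.real (S i) * μ.real (S j))
    (hdiv : Tendsto (fun n => ∑ j ∈ Finset.range n, μ.real (S j)) atTop atTop) :
    ∀ᵐ ω ∂μ, Tendsto (fun n => (∑ j ∈ Finset.range n, (S j).indicator (1 : Ω → ℝ) ω) /
      ∑ j ∈ Finset.range n, μ.real (S j)) atTop (𝓝 1) := by
  set M : ℕ → ℝ := fun n => ∑ j ∈ Finset.range n, μ.real (S j) with hMdef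
  have hM : Monotone M := monotone_nat_of_le_succ fun n => by
    simp only [hMdef, Finset.sum_range_succ]
    linarith [measureReal_nonneg (μ := μ) (s := S n)]
  have hex : ∀ m : ℕ, ∃ n, (m : ℝ) ^ 2 ≤ M n := fun m => (hdiv.eventually_ge_atTop _).exists
  classical
  -- `N m` is the first index at which the mean reaches `m²`; it overshoots by at most `1`, as each
  -- event adds at most `1`.
  set N : ℕ → ℕ := fun m => Nat.find (hex m) with hNdef
  have hN : ∀ m n : ℕ, (m : ℝ) ^ 2 ≤ M n ↔ N m ≤ n := fun m n =>
    ⟨fun h => Nat.find_min' _ h, fun h => (Nat.find_spec (hex m)).trans (hM h)⟩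
  have hNle : ∀ m : ℕ, M (N m) ≤ (m : ℝ) ^ 2 + 1 := fun m => by
    rcases h : N m with _ | n
    · simp only [hMdef, Finset.range_zero, Finset.sum_empty]
      positivity
    · have h1 : ¬ (m : ℝ) ^ 2 ≤ M n := fun h' => by
        have := (hN m n).mp h'
        omega
      have h2 : μ.real (S n) ≤ 1 := measureReal_le_one
      simp only [hMdef, Finset.sum_range_succ] at h1 ⊢
      linarith
  have hNge : ∀ m : ℕ, (m : ℝ) ^ 2 ≤ M (N m) := fun m => (hN m _).mpr le_rfl
  have hMlim : Tendsto (fun m : ℕ => M (N m) / (m : ℝ) ^ 2) atTop (𝓝 1) := by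
    have h1 : Tendsto (fun m : ℕ => 1 + (((m : ℝ)⁻¹) ^ 2)) atTop (𝓝 1) := by
      simpa using (tendsto_inv_atTop_nhds_zero_nat (𝕜 := ℝ)).pow 2 |>.const_add 1
    refine tendsto_of_tendsto_of_tendsto_of_le_of_le' tendsto_const_nhds h1 ?_ ?_ <;>
      filter_upwards [eventually_ge_atTop 1] with m hm
    all_goals have hm0 : (0 : ℝ) < m := by exact_mod_cast hm
    · rw [le_div_iff₀ (by positivity), one_mul]
      exact hNge m
    · rw [div_le_iff₀ (by positivity), add_mul, inv_pow, inv_mul_cancel₀ (by positivity), one_mul]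
      exact hNle m
  -- The squared deviation at `N m`, relative to `m²`. Its mean is at most `4k / m²`, which is
  -- summable, so almost surely `∑ Z m` is finite and `Z m → 0`.
  set Z : ℕ → Ω → ℝ := fun m ω =>
    (∑ j ∈ Finset.range (N m), ((S j).indicator (1 : Ω → ℝ) ω - μ.real (S j))) ^ 2 *
      (((m : ℝ) ^ 2)⁻¹) ^ 2 with hZ
  have hZint : ∀ m, Integrable (Z m) μ := fun m =>
    (integrable_sq_sum_indicator_sub hS (N m)).mul_const _
  have hZ0 : ∀ m ω, 0 ≤ Z m ω := fun m ω => by positivity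
  have hZle : ∀ m, ∫ ω, Z m ω ∂μ ≤ 4 * k * (1 / (m : ℝ) ^ 2) := fun m => by
    rw [hZ, integral_mul_const]
    rcases Nat.eq_zero_or_pos m with rfl | hm
    · simp
    · have hm1 : (1 : ℝ) ≤ m := by exact_mod_cast hm
      have h1 := integral_sq_sum_indicator_sub_le hS hind (N m)
      have h2 : 2 * (k : ℝ) * M (N m) ≤ 2 * k * ((m : ℝ) ^ 2 + (m : ℝ) ^ 2) :=
        mul_le_mul_of_nonneg_left ((hNle m).trans (by nlinarith)) (by positivity)
      calc _ ≤ 2 * k * ((m : ℝ) ^ 2 + (m : ℝ) ^ 2) * (((m : ℝ) ^ 2)⁻¹) ^ 2 :=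
            mul_le_mul_of_nonneg_right (h1.trans h2) (by positivity)
        _ = _ := by
            field_simp
            ring
  have hsum : ∑' m, ∫⁻ ω, ENNReal.ofReal (Z m ω) ∂μ ≠ ⊤ := by
    have hs : Summable fun m : ℕ => 4 * (k : ℝ) * (1 / (m : ℝ) ^ 2) :=
      (Real.summable_one_div_nat_pow.mpr (by norm_num)).mul_left _
    refine ne_top_of_le_ne_top hs.tsum_ofReal_ne_top (ENNReal.tsum_le_tsum fun m => ?_)
    rw [← ofReal_integral_eq_lintegral_ofReal (hZint m) (ae_of_all _ (hZ0 m))]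
    exact ENNReal.ofReal_le_ofReal (hZle m)
  have hmeas : ∀ m, AEMeasurable (fun ω => ENNReal.ofReal (Z m ω)) μ := fun m =>
    (hZint m).aestronglyMeasurable.aemeasurable.ennreal_ofReal
  rw [← lintegral_tsum hmeas] at hsum
  filter_upwards [ae_lt_top' (AEMeasurable.tsum hmeas) hsum] with ω hω
  have hZlim : Tendsto (fun m => Z m ω) atTop (𝓝 0) := by
    have h1 := (ENNReal.tendsto_toReal ENNReal.zero_ne_top).comp
      (ENNReal.tendsto_atTop_zero_of_tsum_ne_top hω.ne)
    simpa [Function.comp_def, ENNReal.toReal_ofReal (hZ0 _ ω)] using h1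
  have hdiff : Tendsto (fun m => (∑ j ∈ Finset.range (N m),
      ((S j).indicator (1 : Ω → ℝ) ω - μ.real (S j))) * ((m : ℝ) ^ 2)⁻¹) atTop (𝓝 0) := by
    have h1 := (Real.continuous_sqrt.tendsto 0).comp hZlim
    rw [Real.sqrt_zero] at h1
    refine (tendsto_zero_iff_abs_tendsto_zero _).mpr (h1.congr fun m => ?_)
    simp only [Function.comp_apply, hZ, ← mul_pow, Real.sqrt_sq_eq_abs]
  refine tendsto_div_of_tendsto_subseq (monotone_nat_of_le_succ fun n => ?_)
    (fun n => Finset.sum_nonneg fun j _ => Set.indicator_nonneg (fun _ _ => zero_le_one) _)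
    hN hdiv ?_
  · rw [Finset.sum_range_succ]
    exact le_add_of_nonneg_right (Set.indicator_nonneg (fun _ _ => zero_le_one) _)
  · have h1 := hdiff.add hMlim
    rw [zero_add] at h1
    refine h1.congr fun m => ?_
    simp only [hMdef, Finset.sum_sub_distrib]
    ring

end FiniteRangeDependence

open MeasureTheory

/-! ### Random digits and their block counts -/

/-- The law of a sequence of independent digits, of which the `n`-th is uniformly distributed on
`{a n, …, q n - 1}`. -/
noncomputable def digitMeasure {a q : ℕ → ℕ} (haq : ∀ n, a n < q n) : Measure (ℕ → ℕ) :=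
  Measure.infinitePi fun n =>
    (PMF.uniformOfFinset (Finset.Ico (a n) (q n)) (Finset.nonempty_Ico.mpr (haq n))).toMeasure

/-- The set of sequences that agree with `e` on the finite set `s`. -/
def box (s : Finset ℕ) (e : ℕ → ℕ) : Set (ℕ → ℕ) := {ω | ∀ i ∈ s, ω i = e i}

section DigitMeasure

variable {a q : ℕ → ℕ} {haq : ∀ n, a n < q n}

instance : IsProbabilityMeasure (digitMeasure haq) := by
  unfold digitMeasure
  infer_instance

theorem measurableSet_box (s : Finset ℕ) (e : ℕ → ℕ) : MeasurableSet (box s e) := by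
  have : box s e = ⋂ i ∈ s, {ω : ℕ → ℕ | ω i = e i} := by
    ext
    simp [box]
  rw [this]
  exact Finset.measurableSet_biInter _ fun i _ =>
    measurableSet_eq_fun (measurable_pi_apply i) measurable_const

theorem digitMeasure_real_box (s : Finset ℕ) (e : ℕ → ℕ) : (digitMeasure haq).real (box s e) =
    ∏ i ∈ s, if e i ∈ Finset.Ico (a i) (q i) then ((q i - a i : ℕ) : ℝ)⁻¹ else 0 := by
  have h : box s e = (s : Set ℕ).pi fun i => {e i} := by
    ext
    simp [box]
  rw [measureReal_def, h, digitMeasure, Measure.infinitePi_pi _ fun i _ => .of_discrete,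
    ENNReal.toReal_prod]
  refine Finset.prod_congr rfl fun i _ => ?_
  rw [PMF.toMeasure_apply_singleton _ _ .of_discrete, PMF.uniformOfFinset_apply]
  split_ifs
  · rw [ENNReal.toReal_inv, Nat.card_Ico, ENNReal.toReal_natCast]
  · simp

theorem digitMeasure_real_box_inter {s t : Finset ℕ} (hst : Disjoint s t) (e f : ℕ → ℕ) :
    (digitMeasure haq).real (box s e ∩ box t f) =
      (digitMeasure haq).real (box s e) * (digitMeasure haq).real (box t f) := by
  have h : box s e ∩ box t f = box (s ∪ t) fun i => if i ∈ s then e i else f i := by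
    ext ω
    simp only [box, Set.mem_inter_iff, Set.mem_ofPred_eq, Finset.mem_union]
    constructor
    · rintro ⟨h1, h2⟩ i hi
      split_ifs with h3
      · exact h1 i h3
      · exact h2 i (hi.resolve_left h3)
    · intro h1
      refine ⟨fun i hi => by simpa [hi] using h1 i (Or.inl hi), fun i hi => ?_⟩
      simpa [Finset.disjoint_right.mp hst hi] using h1 i (Or.inr hi)
  rw [h, digitMeasure_real_box, digitMeasure_real_box, digitMeasure_real_box,
    Finset.prod_union hst]
  refine congrArg₂ _ (Finset.prod_congr rfl fun i hi => by simp [hi])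
    (Finset.prod_congr rfl fun i hi => by simp [Finset.disjoint_right.mp hst hi])

theorem ae_digitMeasure_mem : ∀ᵐ ω ∂digitMeasure haq, ∀ n, ω n ∈ Finset.Ico (a n) (q n) := by
  rw [ae_all_iff]
  intro n
  have h : {ω : ℕ → ℕ | ¬ ω n ∈ Finset.Ico (a n) (q n)} ⊆
      ⋃ m : {m : ℕ // m ∉ Finset.Ico (a n) (q n)}, box {n} fun _ => m := fun ω hω =>
    Set.mem_iUnion.mpr ⟨⟨ω n, hω⟩, by simp [box]⟩
  refine measure_mono_null h (measure_iUnion_null fun m => ?_)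
  have h1 := digitMeasure_real_box (haq := haq) {n} fun _ => m
  rw [Finset.prod_singleton, if_neg m.2] at h1
  exact (measureReal_eq_zero_iff).mp h1

/-- The weight `1 / (q_j ⋯ q_{j+k-1})` of the window of length `k` at `j` if all digits in it are
unrestricted, and `0` otherwise. -/
noncomputable def freeWeight (a q : ℕ → ℕ) (k j : ℕ) : ℝ :=
  if ∀ i < k, a (j + i) = 0 then 1 / ∏ i ∈ Finset.range k, (q (j + i) : ℝ) else 0

/-- Brings occurrences of a block into the form for which the product formula is available; the
value `0` off the window is never read. -/
theorem setOf_block_eq_box {k : ℕ} (B : Fin k → ℕ) (j : ℕ) :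
    {ω : ℕ → ℕ | ∀ i : Fin k, ω (j + i) = B i} =
      box (Finset.Ico j (j + k)) fun m => if h : m - j < k then B ⟨m - j, h⟩ else 0 := by
  ext ω
  simp only [box, Set.mem_ofPred_eq, Finset.mem_Ico]
  constructor
  · intro h m hm
    have h1 : m - j < k := by omega
    have h2 := h ⟨m - j, h1⟩
    rw [dif_pos h1, ← h2, Nat.add_sub_cancel' hm.1]
  · intro h i
    have h1 := h (j + i) ⟨by omega, by omega⟩
    simpa using h1

/-- Once the bases and the nonzero lower bounds `a n` exceed every entry of `B`, a restricted place
in the window rules `B` out, and a free window admits all its entries. -/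
theorem eventually_real_block_eq (hq : Tendsto q atTop atTop)
    (ha : ∀ b, ∀ᶠ n in atTop, a n = 0 ∨ b < a n) {k : ℕ} (B : Fin k → ℕ) :
    ∀ᶠ j in atTop, (digitMeasure haq).real {ω | ∀ i : Fin k, ω (j + i) = B i} =
      freeWeight a q k j := by
  set b := ∑ i, B i with hb
  have hB : ∀ i, B i ≤ b := fun i => Finset.single_le_sum (fun _ _ => Nat.zero_le _)
    (Finset.mem_univ i)
  obtain ⟨N, hN⟩ := eventually_atTop.mp ((ha b).and (hq.eventually_gt_atTop b))
  filter_upwards [eventually_ge_atTop N] with j hj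
  rw [setOf_block_eq_box, digitMeasure_real_box, Finset.prod_Ico_eq_prod_range,
    Nat.add_sub_cancel_left, freeWeight]
  split_ifs with h
  · rw [one_div, ← Finset.prod_inv_distrib]
    refine Finset.prod_congr rfl fun i hi => ?_
    have hi := Finset.mem_range.mp hi
    have h1 := (hN (j + i) (by omega)).2
    have h2 := hB ⟨i, hi⟩
    simp only [Nat.add_sub_cancel_left, hi, dif_pos, h i hi, Finset.mem_Ico, Nat.sub_zero]
    rw [if_pos ⟨Nat.zero_le _, by omega⟩]
  · push Not at h
    obtain ⟨i, hi, hai⟩ := h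
    refine Finset.prod_eq_zero (Finset.mem_range.mpr hi) ?_
    have h1 := (hN (j + i) (by omega)).1.resolve_left hai
    have h2 := hB ⟨i, hi⟩
    simp only [Nat.add_sub_cancel_left, hi, dif_pos, Finset.mem_Ico]
    rw [if_neg (by omega)]

/-- The finitely many terms that differ contribute a constant, which divergence absorbs. -/
theorem tendsto_sum_div_sum_of_eventuallyEq {f g : ℕ → ℝ} (h : f =ᶠ[atTop] g)
    (hg : Tendsto (fun n => ∑ j ∈ Finset.range n, g j) atTop atTop) :
    Tendsto (fun n => (∑ j ∈ Finset.range n, f j) / ∑ j ∈ Finset.range n, g j) atTop (𝓝 1) := by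
  obtain ⟨N, hN⟩ := eventually_atTop.mp h
  set C := ∑ j ∈ Finset.range N, (f j - g j) with hC
  have h1 : Tendsto (fun n => 1 + C / ∑ j ∈ Finset.range n, g j) atTop (𝓝 1) := by
    simpa using (hg.const_div_atTop C).const_add 1
  refine h1.congr' ?_
  filter_upwards [eventually_ge_atTop N, hg.eventually_gt_atTop 0] with n hn hpos
  have h2 : ∑ j ∈ Finset.range n, (f j - g j) = C := by
    rw [hC, ← Finset.sum_range_add_sum_Ico _ hn, add_eq_left]
    exact Finset.sum_eq_zero fun j hj => by rw [hN j (Finset.mem_Ico.mp hj).1, sub_self]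
  rw [Finset.sum_sub_distrib] at h2
  rw [← h2]
  field_simp
  ring

theorem ae_tendsto_blockCount_div (hq : Tendsto q atTop atTop)
    (ha : ∀ b, ∀ᶠ n in atTop, a n = 0 ∨ b < a n) (k : ℕ)
    (hdiv : Tendsto (fun n => ∑ j ∈ Finset.range n, freeWeight a q k j) atTop atTop) :
    ∀ᵐ ω ∂digitMeasure haq, ∀ B : Fin k → ℕ, Tendsto (fun n => (blockCount ω B n : ℝ) /
      ∑ j ∈ Finset.range n, freeWeight a q k j) atTop (𝓝 1) := by
  rw [ae_all_iff]
  intro B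
  set S : ℕ → Set (ℕ → ℕ) := fun j => {ω | ∀ i : Fin k, ω (j + i) = B i} with hSdef
  have hS : ∀ j, MeasurableSet (S j) := fun j => by
    simp only [hSdef, setOf_block_eq_box]
    exact measurableSet_box _ _
  have hind : ∀ i j, i + k ≤ j → (digitMeasure haq).real (S i ∩ S j) =
      (digitMeasure haq).real (S i) * (digitMeasure haq).real (S j) := fun i j hij => by
    simp only [hSdef, setOf_block_eq_box]
    exact digitMeasure_real_box_inter (Finset.Ico_disjoint_Ico_consecutive i (i + k) (j + k)
      |>.mono_right (Finset.Ico_subset_Ico_left hij)) _ _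
  have hev := tendsto_sum_div_sum_of_eventuallyEq
    (eventually_real_block_eq (haq := haq) hq ha B) hdiv
  have hdiv' : Tendsto (fun n => ∑ j ∈ Finset.range n, (digitMeasure haq).real (S j))
      atTop atTop := by
    refine (hev.pos_mul_atTop one_pos hdiv).congr' ?_
    filter_upwards [hdiv.eventually_gt_atTop 0] with n hn
    exact div_mul_cancel₀ _ hn.ne'
  filter_upwards [ae_tendsto_sum_indicator_div hS hind hdiv'] with ω hω
  have h1 := hω.mul hev
  rw [mul_one] at h1
  refine h1.congr' ?_
  filter_upwards [hdiv'.eventually_gt_atTop 0] with n hn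
  have h2 : (blockCount ω B n : ℝ) =
      ∑ j ∈ Finset.range n, (S j).indicator (1 : (ℕ → ℕ) → ℝ) ω := by
    classical
    simp [blockCount, hSdef, Set.indicator_apply]
  rw [h2]
  exact div_mul_div_cancel₀ hn.ne'

end DigitMeasure

/-! ### Positions within parts and copies -/

section Places

variable {s t υ : ℕ → ℕ}

theorem partStart_succ (s t υ : ℕ → ℕ) (i : ℕ) :
    partStart s t υ (i + 1) = partStart s t υ i + υ i * (s i + t i) :=
  Finset.sum_range_succ _ _

theorem monotone_partStart (s t υ : ℕ → ℕ) : Monotone (partStart s t υ) :=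
  monotone_nat_of_le_succ fun i => by
    rw [partStart_succ]
    exact Nat.le_add_right _ _

/-- Parts may be empty, so this needs a reason. If the starts were bounded, every late position
would have part index `sInf ∅ = 0`, and only the values `α 0` and `β 0` could occur there, against
`q n → ∞`. -/
theorem tendsto_partStart {α β : ℕ → ℕ} (h : InfiniteInLimit (blockSeq α β s t υ)) :
    Tendsto (partStart s t υ) atTop atTop := by
  refine tendsto_atTop_atTop_of_monotone (monotone_partStart s t υ) fun b => ?_
  by_contra! hb
  obtain ⟨n, hn, hbn⟩ := ((h.eventually_gt_atTop (max (α 0) (β 0))).and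
    (eventually_ge_atTop b)).exists
  have h0 : partIndex s t υ n = 0 := by
    have : {i | n < partStart s t υ (i + 1)} = ∅ :=
      Set.eq_empty_of_forall_notMem fun i (hi : n < _) => by
        have := hb (i + 1)
        omega
    rw [partIndex, this, Nat.sInf_empty]
  rw [blockSeq, h0] at hn
  split_ifs at hn <;> omega

theorem exists_place (h : Tendsto (partStart s t υ) atTop atTop) (n : ℕ) :
    ∃ i c d, c < υ i ∧ d < s i + t i ∧ partStart s t υ i + c * (s i + t i) + d = n := by
  have hex : ∃ i, n < partStart s t υ i := (h.eventually_gt_atTop n).exists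
  classical
  rcases hi : Nat.find hex with _ | i
  · have h0 : n < partStart s t υ 0 := hi ▸ Nat.find_spec hex
    simp [partStart] at h0
  · have h1 : n < partStart s t υ (i + 1) := hi ▸ Nat.find_spec hex
    have h2 : partStart s t υ i ≤ n := not_lt.mp (Nat.find_min hex (by omega))
    rw [partStart_succ] at h1
    have hpos : 0 < s i + t i := by
      by_contra h0
      rw [Nat.eq_zero_of_not_pos h0] at h1
      omega
    refine ⟨i, (n - partStart s t υ i) / (s i + t i), (n - partStart s t υ i) % (s i + t i),
      (Nat.div_lt_iff_lt_mul hpos).mpr (by omega), Nat.mod_lt _ hpos, ?_⟩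
    have := Nat.div_add_mod' (n - partStart s t υ i) (s i + t i)
    omega

theorem sum_range_partStart_le {h : ℕ → ℝ} {i₀ : ℕ}
    (hh : ∀ i, i₀ ≤ i → ∀ c < υ i, 0 ≤ ∑ d ∈ Finset.range (s i + t i),
      h (partStart s t υ i + c * (s i + t i) + d)) {i c : ℕ} (hi : i₀ ≤ i) (hc : c ≤ υ i) :
    ∑ j ∈ Finset.range (partStart s t υ i₀), h j ≤
      ∑ j ∈ Finset.range (partStart s t υ i + c * (s i + t i)), h j := by
  have step : ∀ i, i₀ ≤ i → ∀ c ≤ υ i, ∑ j ∈ Finset.range (partStart s t υ i), h j ≤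
      ∑ j ∈ Finset.range (partStart s t υ i + c * (s i + t i)), h j := by
    intro i hi c hc
    induction c with
    | zero => simp
    | succ c ih =>
      rw [add_mul, one_mul, ← add_assoc, Finset.sum_range_add]
      linarith [ih (by omega), hh i hi c hc]
  refine le_trans ?_ (step i hi c hc)
  clear hc
  induction i, hi using Nat.le_induction with
  | base => exact le_rfl
  | succ i hi ih =>
    rw [partStart_succ]
    exact ih.trans (step i hi _ le_rfl)

/-- Reduces an inequality for all `n` to one for initial segments of a single copy: complete copies
contribute nonnegatively, and `n` cuts only one copy. -/
theorem sum_range_le_of_prefix {h : ℕ → ℝ} {i₀ : ℕ} (htop : Tendsto (partStart s t υ) atTop atTop)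
    (hh : ∀ i, i₀ ≤ i → ∀ c < υ i, ∀ m ≤ s i + t i, 0 ≤ ∑ d ∈ Finset.range m,
      h (partStart s t υ i + c * (s i + t i) + d)) {n : ℕ} (hn : partStart s t υ i₀ ≤ n) :
    ∑ j ∈ Finset.range (partStart s t υ i₀), h j ≤ ∑ j ∈ Finset.range n, h j := by
  obtain ⟨i, c, d, hc, hd, rfl⟩ := exists_place htop n
  have hi : i₀ ≤ i := by
    by_contra hlt
    have h1 := monotone_partStart s t υ (show i + 1 ≤ i₀ by omega)
    have h2 : (c + 1) * (s i + t i) ≤ υ i * (s i + t i) := Nat.mul_le_mul_right _ hc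
    rw [partStart_succ] at h1
    rw [add_mul, one_mul] at h2
    omega
  rw [Finset.sum_range_add]
  linarith [hh i hi c hc d hd.le, sum_range_partStart_le
    (fun i hi c hc => hh i hi c hc _ le_rfl) hi hc.le]

end Places

/-! ### Weights of windows and their comparison -/

/-- The weight `1 / (q_j ⋯ q_{j+k-1})` of the window of length `k` at `j`. -/
noncomputable def weight (q : ℕ → ℕ) (k j : ℕ) : ℝ := 1 / ∏ i ∈ Finset.range k, (q (j + i) : ℝ)

section Weight

variable {a q : ℕ → ℕ} {k j : ℕ}

theorem expectedCount_eq (q : ℕ → ℕ) (k n : ℕ) :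
    expectedCount q k n = ∑ j ∈ Finset.range n, weight q k j := rfl

theorem weight_nonneg (q : ℕ → ℕ) (k j : ℕ) : 0 ≤ weight q k j := by
  unfold weight
  positivity

theorem weight_le_one (hq : ∀ n, 0 < q n) (k j : ℕ) : weight q k j ≤ 1 := by
  have h : (1 : ℝ) ≤ ∏ i ∈ Finset.range k, (q (j + i) : ℝ) :=
    Finset.one_le_prod fun i _ => by exact_mod_cast hq (j + i)
  exact div_le_one_of_le₀ h (by linarith)

theorem weight_eq_of_const {b : ℕ} (h : ∀ i < k, q (j + i) = b) :
    weight q k j = 1 / (b : ℝ) ^ k := by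
  rw [weight, Finset.prod_congr rfl fun i hi => by rw [h i (Finset.mem_range.mp hi)]]
  simp

theorem freeWeight_nonneg (a q : ℕ → ℕ) (k j : ℕ) : 0 ≤ freeWeight a q k j := by
  unfold freeWeight
  positivity

theorem freeWeight_le_weight (a q : ℕ → ℕ) (k j : ℕ) : freeWeight a q k j ≤ weight q k j := by
  unfold freeWeight
  split_ifs
  · exact le_rfl
  · exact weight_nonneg q k j

theorem freeWeight_eq_weight (h : ∀ i < k, a (j + i) = 0) :
    freeWeight a q k j = weight q k j := if_pos h

theorem freeWeight_eq_zero {i : ℕ} (hi : i < k) (h : a (j + i) ≠ 0) : freeWeight a q k j = 0 :=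
  if_neg fun h' => h (h' i hi)

/-- A longer window has more places to keep free and more bases in its denominator. This carries
divergence of the free sums from the orders `k ≥ ℓ` down to the lower ones. -/
theorem freeWeight_anti (hq : ∀ n, 0 < q n) {l : ℕ} (hkl : k ≤ l) (j : ℕ) :
    freeWeight a q l j ≤ freeWeight a q k j := by
  by_cases h : ∀ i < l, a (j + i) = 0
  · rw [freeWeight_eq_weight h, freeWeight_eq_weight fun i hi => h i (hi.trans_le hkl)]
    refine one_div_le_one_div_of_le (Finset.prod_pos fun i _ => by exact_mod_cast hq _) ?_
    exact Finset.prod_le_prod_of_subset_of_one_le (Finset.range_mono hkl)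
      (fun i _ => by positivity) fun i _ _ => by exact_mod_cast hq (j + i)
  · rw [freeWeight, if_neg h]
    exact freeWeight_nonneg a q k j

end Weight

/-- The constant `C` leaves room for an initial stretch on which the comparison fails. -/
theorem tendsto_div_one_of_forall_le {A Q : ℕ → ℝ} (hAQ : ∀ n, A n ≤ Q n)
    (hQ : Tendsto Q atTop atTop)
    (h : ∀ ε > 0, ∃ C, ∀ᶠ n in atTop, Q n - A n ≤ ε * A n + C) :
    Tendsto (fun n => A n / Q n) atTop (𝓝 1) := by
  rw [Metric.tendsto_atTop']
  intro ε hε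
  obtain ⟨C, hC⟩ := h (ε / 2) (by positivity)
  have hCQ : Tendsto (fun n => C / Q n) atTop (𝓝 0) := hQ.const_div_atTop C
  obtain ⟨N, hN⟩ := eventually_atTop.mp ((hC.and (hQ.eventually_gt_atTop 0)).and
    (hCQ.eventually_lt_const (half_pos hε)))
  refine ⟨N, fun n hn => ?_⟩
  obtain ⟨⟨h1, h2⟩, h3⟩ := hN n hn.le
  have h4 : A n / Q n ≤ 1 := div_le_one_of_le₀ (hAQ n) h2.le
  rw [div_lt_iff₀ h2] at h3
  have h5 : 1 - ε < A n / Q n := by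
    rw [lt_div_iff₀ h2]
    nlinarith [hAQ n]
  rw [Real.dist_eq, abs_lt]
  constructor <;> linarith

/-! ### Free and lost weight in the copies -/

section BlockSeq

variable {α β s t υ : ℕ → ℕ} {k : ℕ}

/-- The least admissible digits: `0` in the runs of `α`, about half the base in the runs of `β`. -/
noncomputable def lowDigit (β s t υ : ℕ → ℕ) : ℕ → ℕ :=
  blockSeq (fun _ => 0) (fun i => β i / 2) s t υ

theorem blockSeq_cases (α β s t υ : ℕ → ℕ) (n : ℕ) :
    (∃ i, lowDigit β s t υ n = 0 ∧ blockSeq α β s t υ n = α i) ∨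
      ∃ i, lowDigit β s t υ n = β i / 2 ∧ blockSeq α β s t υ n = β i := by
  unfold lowDigit blockSeq
  split_ifs
  · exact Or.inl ⟨_, rfl, rfl⟩
  · exact Or.inr ⟨_, rfl, rfl⟩

theorem two_le_blockSeq (hα : IsBasic α) (hβ : IsBasic β) (n : ℕ) :
    2 ≤ blockSeq α β s t υ n := by
  rcases blockSeq_cases α β s t υ n with ⟨i, -, h⟩ | ⟨i, -, h⟩ <;> rw [h]
  exacts [hα i, hβ i]

theorem two_mul_lowDigit_le (n : ℕ) : 2 * lowDigit β s t υ n ≤ blockSeq α β s t υ n := by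
  rcases blockSeq_cases α β s t υ n with ⟨i, h1, h2⟩ | ⟨i, h1, h2⟩ <;> rw [h1, h2] <;> omega

theorem lowDigit_lt (hα : IsBasic α) (hβ : IsBasic β) (n : ℕ) :
    lowDigit β s t υ n < blockSeq α β s t υ n := by
  have h1 := two_mul_lowDigit_le (α := α) (β := β) (s := s) (t := t) (υ := υ) n
  have h2 := two_le_blockSeq (s := s) (t := t) (υ := υ) hα hβ n
  omega

theorem eventually_lowDigit (h : InfiniteInLimit (blockSeq α β s t υ)) (b : ℕ) :
    ∀ᶠ n in atTop, lowDigit β s t υ n = 0 ∨ b < lowDigit β s t υ n := by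
  filter_upwards [h.eventually_ge_atTop (2 * b + 2)] with n hn
  rcases blockSeq_cases α β s t υ n with ⟨i, h1, h2⟩ | ⟨i, h1, h2⟩ <;> rw [h1]
  · exact Or.inl rfl
  · rw [h2] at hn
    right
    omega

variable {i c d : ℕ}

theorem weight_of_le (hc : c < υ i) (hd : d + k ≤ s i) :
    weight (blockSeq α β s t υ) k (partStart s t υ i + c * (s i + t i) + d) =
      1 / (α i : ℝ) ^ k :=
  weight_eq_of_const fun e he => by
    rw [add_assoc, blockSeq_apply α β s t υ hc (by omega), if_pos (by omega)]

theorem freeWeight_of_le (hc : c < υ i) (hd : d + k ≤ s i) :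
    freeWeight (lowDigit β s t υ) (blockSeq α β s t υ) k
      (partStart s t υ i + c * (s i + t i) + d) = 1 / (α i : ℝ) ^ k := by
  rw [freeWeight_eq_weight, weight_of_le hc hd]
  intro e he
  rw [add_assoc, lowDigit, blockSeq_apply _ _ s t υ hc (by omega), if_pos (by omega)]

theorem weight_of_ge (hc : c < υ i) (hd : s i ≤ d) (hd' : d + k ≤ s i + t i) :
    weight (blockSeq α β s t υ) k (partStart s t υ i + c * (s i + t i) + d) =
      1 / (β i : ℝ) ^ k :=
  weight_eq_of_const fun e he => by
    rw [add_assoc, blockSeq_apply α β s t υ hc (by omega), if_neg (by omega)]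

theorem freeWeight_of_gt (hβ : IsBasic β) (hk : 1 ≤ k) (hc : c < υ i) (ht : 1 ≤ t i)
    (hd : s i < d + k) (hd' : d < s i + t i) :
    freeWeight (lowDigit β s t υ) (blockSeq α β s t υ) k
      (partStart s t υ i + c * (s i + t i) + d) = 0 := by
  have h2 := hβ i
  refine freeWeight_eq_zero (i := max d (s i) - d) (by omega) ?_
  rw [add_assoc, lowDigit, blockSeq_apply _ _ s t υ hc (by omega), if_neg (by omega)]
  omega

/-- Windows inside the `α`-run lose nothing, at most `t i` windows inside the `β`-run lose `1 / β^k`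
each, and at most `k` windows across each of the two run ends lose at most `1` each. -/
theorem sum_restricted_le (hα : IsBasic α) (hβ : IsBasic β) (hc : c < υ i) {m : ℕ}
    (hm : m ≤ s i + t i) : ∑ d ∈ Finset.range m,
      (weight (blockSeq α β s t υ) k (partStart s t υ i + c * (s i + t i) + d) -
        freeWeight (lowDigit β s t υ) (blockSeq α β s t υ) k
          (partStart s t υ i + c * (s i + t i) + d)) ≤ t i / (β i : ℝ) ^ k + 2 * k := by
  have hq : ∀ n, 0 < blockSeq α β s t υ n := fun n =>
    Nat.zero_lt_two.trans_le (two_le_blockSeq hα hβ n)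
  have hβk : 0 ≤ 1 / (β i : ℝ) ^ k := by positivity
  have hsum : ∀ (x y n : ℕ) (r : ℝ), 0 ≤ r →
      ∑ d ∈ Finset.range n, (if d ∈ Finset.Ico x y then r else 0) ≤ (y - x : ℕ) * r := by
    intro x y n r hr
    rw [← Finset.sum_filter, Finset.sum_const, nsmul_eq_mul]
    refine mul_le_mul_of_nonneg_right (Nat.cast_le.mpr ?_) hr
    rw [← Nat.card_Ico]
    exact Finset.card_le_card fun d hd => (Finset.mem_filter.mp hd).2
  calc _ ≤ ∑ d ∈ Finset.range m, ((if d ∈ Finset.Ico (s i) (s i + t i) then 1 / (β i : ℝ) ^ k else 0)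
        + (if d ∈ Finset.Ico (s i - k) (s i) then 1 else 0)
        + if d ∈ Finset.Ico (s i + t i - k) (s i + t i) then 1 else 0) := by
        refine Finset.sum_le_sum fun d hd => ?_
        have hd := Finset.mem_range.mp hd
        have hz : ∀ p : Prop, [Decidable p] → (0 : ℝ) ≤ if p then 1 else 0 := fun p _ => by
          split_ifs <;> norm_num
        have hz' : ∀ p : Prop, [Decidable p] → (0 : ℝ) ≤ if p then 1 / (β i : ℝ) ^ k else 0 :=
          fun p _ => by split_ifs <;> linarith
        have hw := weight_le_one hq k (partStart s t υ i + c * (s i + t i) + d)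
        have hf := freeWeight_nonneg (lowDigit β s t υ) (blockSeq α β s t υ) k
          (partStart s t υ i + c * (s i + t i) + d)
        by_cases h1 : d + k ≤ s i
        · rw [weight_of_le hc h1, freeWeight_of_le hc h1, sub_self]
          exact add_nonneg (add_nonneg (hz' _) (hz _)) (hz _)
        by_cases h2 : d < s i
        · rw [if_pos (show d ∈ Finset.Ico (s i - k) (s i) from Finset.mem_Ico.mpr (by omega))]
          linarith [hz' (d ∈ Finset.Ico (s i) (s i + t i)),
            hz (d ∈ Finset.Ico (s i + t i - k) (s i + t i))]
        by_cases h3 : d + k ≤ s i + t i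
        · rw [if_pos (show d ∈ Finset.Ico (s i) (s i + t i) from Finset.mem_Ico.mpr (by omega))]
          rw [weight_of_ge hc (by omega) h3]
          linarith [hz (d ∈ Finset.Ico (s i - k) (s i)),
            hz (d ∈ Finset.Ico (s i + t i - k) (s i + t i))]
        · rw [if_pos (show d ∈ Finset.Ico (s i + t i - k) (s i + t i) from
            Finset.mem_Ico.mpr (by omega))]
          linarith [hz' (d ∈ Finset.Ico (s i) (s i + t i)),
            hz (d ∈ Finset.Ico (s i - k) (s i))]
    _ ≤ (s i + t i - s i : ℕ) * (1 / (β i : ℝ) ^ k) + (s i - (s i - k) : ℕ) * 1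
        + (s i + t i - (s i + t i - k) : ℕ) * 1 := by
        rw [Finset.sum_add_distrib, Finset.sum_add_distrib]
        exact add_le_add (add_le_add (hsum _ _ _ _ hβk) (hsum _ _ _ _ zero_le_one))
          (hsum _ _ _ _ zero_le_one)
    _ ≤ t i / (β i : ℝ) ^ k + 2 * k := by
        have h1 : ((s i - (s i - k) : ℕ) : ℝ) ≤ k := Nat.cast_le.mpr (by omega)
        have h2 : ((s i + t i - (s i + t i - k) : ℕ) : ℝ) ≤ k := Nat.cast_le.mpr (by omega)
        rw [Nat.add_sub_cancel_left, mul_one_div]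
        linarith

theorem le_sum_freeWeight (hc : c < υ i) {m : ℕ} (hm : s i + 1 ≤ m + k) :
    ((s i : ℝ) - k) / (α i : ℝ) ^ k ≤ ∑ d ∈ Finset.range m,
      freeWeight (lowDigit β s t υ) (blockSeq α β s t υ) k
        (partStart s t υ i + c * (s i + t i) + d) := by
  have h0 : 0 ≤ 1 / (α i : ℝ) ^ k := by positivity
  calc ((s i : ℝ) - k) / (α i : ℝ) ^ k ≤ (s i + 1 - k : ℕ) * (1 / (α i : ℝ) ^ k) := by
        rw [mul_one_div, div_eq_mul_one_div, div_eq_mul_one_div ((s i + 1 - k : ℕ) : ℝ)]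
        refine mul_le_mul_of_nonneg_right ?_ h0
        have : s i ≤ (s i + 1 - k) + k := by omega
        have h2 : (s i : ℝ) ≤ (s i + 1 - k : ℕ) + k := by exact_mod_cast this
        linarith
    _ = ∑ d ∈ Finset.range (s i + 1 - k), freeWeight (lowDigit β s t υ) (blockSeq α β s t υ) k
        (partStart s t υ i + c * (s i + t i) + d) := by
        rw [Finset.sum_congr rfl fun d hd => freeWeight_of_le hc (by
          have := Finset.mem_range.mp hd
          omega)]
        simp
    _ ≤ _ := Finset.sum_le_sum_of_subset_of_nonneg (Finset.range_mono (by omega))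
        fun d _ _ => freeWeight_nonneg _ _ _ _

theorem tendsto_div_pow_atTop (hα : IsBasic α) (h : RNQ α s k) :
    Tendsto (fun n => (s n : ℝ) / (α n : ℝ) ^ k) atTop atTop := by
  have h1 : Tendsto (fun n => (α n : ℝ) ^ k / (s n : ℝ)) atTop (𝓝[>] 0) := by
    refine tendsto_nhdsWithin_iff.mpr ⟨h.2, h.1.mono fun n hn => ?_⟩
    have h2 : (0 : ℝ) < α n := by exact_mod_cast Nat.zero_lt_two.trans_le (hα n)
    have h3 : (0 : ℝ) < s n := lt_of_le_of_ne (Nat.cast_nonneg _) (Ne.symm hn)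
    exact div_pos (pow_pos h2 k) h3
  exact h1.inv_tendsto_nhdsGT_zero.congr fun n => inv_div _ _

/-- The order of the runs matters: before a prefix of a copy meets its first lossy window, it has
already collected the free weight of nearly the whole `α`-run. -/
theorem tendsto_sum_freeWeight_div (hα : IsBasic α) (hβ : IsBasic β)
    (hlim : InfiniteInLimit (blockSeq α β s t υ))
    (hQ : Tendsto (expectedCount (blockSeq α β s t υ) k) atTop atTop)
    (hNQ : NQ α β s t k) (hRNQ : RNQ α s k) :
    Tendsto (fun n => (∑ j ∈ Finset.range n,
      freeWeight (lowDigit β s t υ) (blockSeq α β s t υ) k j) /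
        expectedCount (blockSeq α β s t υ) k n) atTop (𝓝 1) := by
  set f := freeWeight (lowDigit β s t υ) (blockSeq α β s t υ) k with hf
  set w := weight (blockSeq α β s t υ) k with hw
  have hfw : ∀ j, f j ≤ w j := freeWeight_le_weight _ _ _
  have hf0 : ∀ j, 0 ≤ f j := freeWeight_nonneg _ _ _
  refine tendsto_div_one_of_forall_le (fun n => Finset.sum_le_sum fun j _ => hfw j) hQ
    fun ε hε => ?_
  have hx := tendsto_div_pow_atTop hα hRNQ
  -- With `x = s i / α i ^ k`, the loss `t / β^k + 2k` is at most `εx/4 + εx/4`, while the free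
  -- weight is at least `x - k ≥ x/2`.
  obtain ⟨i₀, hi₀⟩ := eventually_atTop.mp (((hNQ.1.and
    (hNQ.2.eventually_lt_const (show 0 < ε / 4 by positivity))).and
    (hx.eventually_ge_atTop (8 * k / ε))).and (hx.eventually_ge_atTop (2 * k)))
  have htop := tendsto_partStart hlim
  refine ⟨-∑ j ∈ Finset.range (partStart s t υ i₀), (ε * f j - (w j - f j)), ?_⟩
  filter_upwards [eventually_ge_atTop (partStart s t υ i₀)] with n hn
  have key := sum_range_le_of_prefix (h := fun j => ε * f j - (w j - f j)) htop ?_ hn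
  · simp only [Finset.sum_sub_distrib, ← Finset.mul_sum, expectedCount_eq] at key ⊢
    linarith
  intro i hi c hc m hm
  obtain ⟨⟨⟨h1, h2⟩, h3⟩, h4⟩ := hi₀ i hi
  rw [Finset.sum_sub_distrib, ← Finset.mul_sum, sub_nonneg]
  rcases Nat.lt_or_ge (m + k) (s i + 1) with hmk | hmk
  · rw [Finset.sum_eq_zero fun d hd => ?_]
    · exact mul_nonneg hε.le (Finset.sum_nonneg fun d _ => hf0 _)
    · have hd := Finset.mem_range.mp hd
      rw [hw, hf, weight_of_le hc (by omega), freeWeight_of_le hc (by omega), sub_self]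
  · refine (sum_restricted_le hα hβ hc hm).trans
      (le_trans ?_ (mul_le_mul_of_nonneg_left (le_sum_freeWeight hc hmk) hε.le))
    have hα0 : (1 : ℝ) ≤ (α i : ℝ) ^ k :=
      one_le_pow₀ (by exact_mod_cast one_le_two.trans (hα i))
    have hβ0 : (0 : ℝ) < (β i : ℝ) ^ k :=
      pow_pos (by exact_mod_cast Nat.zero_lt_two.trans_le (hβ i)) k
    have hs0 : (0 : ℝ) < s i :=
      lt_of_le_of_ne (Nat.cast_nonneg _) fun h => h1 (by rw [← h, zero_mul])
    have h5 : t i / (β i : ℝ) ^ k ≤ ε / 4 * (s i / (α i : ℝ) ^ k) := by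
      rw [div_lt_iff₀ (by positivity)] at h2
      rw [div_le_iff₀ hβ0, ← mul_div_assoc, div_mul_eq_mul_div, le_div_iff₀ (by positivity)]
      linarith
    have h6 : 8 * k ≤ s i / (α i : ℝ) ^ k * ε := (div_le_iff₀ hε).mp h3
    have h7 : (k : ℝ) / (α i : ℝ) ^ k ≤ k := div_le_self (Nat.cast_nonneg _) hα0
    rw [sub_div]
    nlinarith

/-- In each late copy the loss is at least `δ/2` times the free weight. Hence at the starts of the
parts the expected count exceeds `1 + δ/2` times the free sum up to a constant, and a limit `1` is
impossible. -/
theorem not_tendsto_sum_freeWeight_div (hα : IsBasic α) (hβ : IsBasic β) (hk : 1 ≤ k)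
    (hlim : InfiniteInLimit (blockSeq α β s t υ))
    (hQ : Tendsto (expectedCount (blockSeq α β s t υ) k) atTop atTop)
    (hNotNQ : NotNQ α β s t k) (hRNQ : RNQ α s k) :
    ¬ Tendsto (fun n => (∑ j ∈ Finset.range n,
      freeWeight (lowDigit β s t υ) (blockSeq α β s t υ) k j) /
        expectedCount (blockSeq α β s t υ) k n) atTop (𝓝 1) := by
  set f := freeWeight (lowDigit β s t υ) (blockSeq α β s t υ) k with hf
  set w := weight (blockSeq α β s t υ) k with hw
  have hfw : ∀ j, f j ≤ w j := freeWeight_le_weight _ _ _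
  intro hcontra
  obtain ⟨hne, L, hL, hlimL⟩ := hNotNQ
  -- A real number strictly below `L` also covers the case `L = ∞`.
  obtain ⟨δ, hδ0, hδL⟩ := EReal.lt_iff_exists_real_btwn.mp hL
  have hδ : 0 < δ := by exact_mod_cast hδ0
  have hx := tendsto_div_pow_atTop hα hRNQ
  -- The threshold `2k / δ` forces `t i ≥ 2k`, so at least `t i / 2` windows lie wholly in the
  -- `β`-run.
  obtain ⟨i₀, hi₀⟩ := eventually_atTop.mp ((hne.and (hlimL.eventually_const_lt hδL)).and
    (hx.eventually_ge_atTop (2 * k / δ)))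
  have htop := tendsto_partStart hlim
  set C := ∑ j ∈ Finset.range (partStart s t υ i₀), ((w j - f j) - δ / 2 * f j) with hC
  have hcopy : ∀ i, i₀ ≤ i → ∀ c < υ i, 0 ≤ ∑ d ∈ Finset.range (s i + t i),
      ((w (partStart s t υ i + c * (s i + t i) + d) - f (partStart s t υ i + c * (s i + t i) + d))
        - δ / 2 * f (partStart s t υ i + c * (s i + t i) + d)) := by
    intro i hi c hc
    obtain ⟨⟨h1, h2⟩, h3⟩ := hi₀ i hi
    have h2 : δ < (t i : ℝ) * (α i : ℝ) ^ k / ((s i : ℝ) * (β i : ℝ) ^ k) := by exact_mod_cast h2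
    have hα0 : (0 : ℝ) < (α i : ℝ) ^ k :=
      pow_pos (by exact_mod_cast Nat.zero_lt_two.trans_le (hα i)) k
    have hβ0 : (1 : ℝ) ≤ (β i : ℝ) ^ k :=
      one_le_pow₀ (by exact_mod_cast one_le_two.trans (hβ i))
    have hs0 : (0 : ℝ) < s i :=
      lt_of_le_of_ne (Nat.cast_nonneg _) fun h => h1 (by rw [← h, zero_mul])
    have h4 : δ * (s i / (α i : ℝ) ^ k) ≤ t i / (β i : ℝ) ^ k := by
      rw [lt_div_iff₀ (by positivity)] at h2
      rw [le_div_iff₀ (by positivity), ← mul_div_assoc, div_mul_eq_mul_div, div_le_iff₀ hα0]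
      linarith
    have h5 : 2 * (k : ℝ) ≤ t i := by
      have h6 := (div_le_iff₀ hδ).mp h3
      have h7 : (t i : ℝ) / (β i : ℝ) ^ k ≤ t i := div_le_self (Nat.cast_nonneg _) hβ0
      linarith
    have h5' : 2 * k ≤ t i := by exact_mod_cast h5
    rw [Finset.sum_sub_distrib, ← Finset.mul_sum, sub_nonneg]
    have hup : ∑ d ∈ Finset.range (s i + t i), f (partStart s t υ i + c * (s i + t i) + d) ≤
        s i / (α i : ℝ) ^ k := by
      rw [Finset.sum_range_add, Finset.sum_eq_zero (s := Finset.range (t i)) fun d hd => ?_,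
        add_zero]
      · calc _ ≤ ∑ d ∈ Finset.range (s i), 1 / (α i : ℝ) ^ k := by
              refine Finset.sum_le_sum fun d hd => ?_
              have hd := Finset.mem_range.mp hd
              by_cases hdk : d + k ≤ s i
              · rw [hf, freeWeight_of_le hc hdk]
              · rw [hf, freeWeight_of_gt hβ hk hc (by omega) (by omega) (by omega)]
                positivity
          _ = _ := by simp [div_eq_mul_inv]
      · have hd := Finset.mem_range.mp hd
        rw [hf, freeWeight_of_gt hβ hk hc (by omega) (by omega) (by omega)]
    have hlow : (t i : ℝ) / 2 / (β i : ℝ) ^ k ≤ ∑ d ∈ Finset.range (s i + t i),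
        (w (partStart s t υ i + c * (s i + t i) + d) -
          f (partStart s t υ i + c * (s i + t i) + d)) := by
      calc _ ≤ ((t i - k : ℕ) : ℝ) * (1 / (β i : ℝ) ^ k) := by
            rw [mul_one_div, Nat.cast_sub (by omega)]
            exact div_le_div_of_nonneg_right (by linarith) (by positivity)
        _ = ∑ d ∈ Finset.Ico (s i) (s i + (t i - k)),
            (w (partStart s t υ i + c * (s i + t i) + d) -
              f (partStart s t υ i + c * (s i + t i) + d)) := by
            rw [Finset.sum_congr rfl fun d hd => ?_, Finset.sum_const, Nat.card_Ico,
              Nat.add_sub_cancel_left, nsmul_eq_mul]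
            have hd := Finset.mem_Ico.mp hd
            rw [hw, hf, weight_of_ge hc (by omega) (by omega),
              freeWeight_of_gt hβ hk hc (by omega) (by omega) (by omega), sub_zero]
        _ ≤ _ := by
            refine Finset.sum_le_sum_of_subset_of_nonneg (fun d hd => ?_)
              fun d _ _ => sub_nonneg.mpr (hfw _)
            have hd := Finset.mem_Ico.mp hd
            exact Finset.mem_range.mpr (by omega)
    calc _ ≤ δ / 2 * (s i / (α i : ℝ) ^ k) := mul_le_mul_of_nonneg_left hup (by positivity)
      _ ≤ (t i : ℝ) / 2 / (β i : ℝ) ^ k := by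
          rw [div_right_comm]
          linarith
      _ ≤ _ := hlow
  have hineq : ∀ i, i₀ ≤ i → C ≤ expectedCount (blockSeq α β s t υ) k (partStart s t υ i) -
      (1 + δ / 2) * ∑ j ∈ Finset.range (partStart s t υ i), f j := fun i hi => by
    have h1 := sum_range_partStart_le (h := fun j => (w j - f j) - δ / 2 * f j) hcopy hi
      (Nat.zero_le _)
    rw [zero_mul, add_zero, ← hC] at h1
    refine h1.trans_eq ?_
    simp only [Finset.sum_sub_distrib, ← Finset.mul_sum, expectedCount_eq]
    ring
  have hl1 : Tendsto (fun i => C / expectedCount (blockSeq α β s t υ) k (partStart s t υ i) +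
      (1 + δ / 2) * ((∑ j ∈ Finset.range (partStart s t υ i), f j) /
        expectedCount (blockSeq α β s t υ) k (partStart s t υ i))) atTop
      (𝓝 (0 + (1 + δ / 2) * 1)) :=
    ((hQ.comp htop).const_div_atTop C).add ((hcontra.comp htop).const_mul _)
  have hle := le_of_tendsto hl1 (b := 1) <| by
    filter_upwards [eventually_ge_atTop i₀, (hQ.comp htop).eventually_gt_atTop 0] with i hi hpos
    have hpos : 0 < expectedCount (blockSeq α β s t υ) k (partStart s t υ i) := hpos
    rw [← mul_div_assoc, ← add_div, div_le_one hpos]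
    linarith [hineq i hi]
  linarith

end BlockSeq

/-! ### Mass distribution and Hausdorff dimension -/

/-- The real number with the digits `ω`. -/
noncomputable def cantorSum (q ω : ℕ → ℕ) : ℝ := ∑' n, (ω n : ℝ) / denom q (n + 1)

section Dimension

variable {a q : ℕ → ℕ} {haq : ∀ n, a n < q n}

theorem hasSum_cantorSum {ω : ℕ → ℕ} (hω : ∀ n, ω n < q n) :
    HasSum (fun n => (ω n : ℝ) / denom q (n + 1)) (cantorSum q ω) :=
  (summable_digits hω).hasSum

theorem ae_lt : ∀ᵐ ω ∂digitMeasure haq, ∀ n, ω n < q n :=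
  ae_digitMeasure_mem.mono fun _ h n => (Finset.mem_Ico.mp (h n)).2

theorem aemeasurable_cantorSum : AEMeasurable (cantorSum q) (digitMeasure haq) := by
  refine aemeasurable_of_tendsto_metrizable_ae atTop (f := fun n ω =>
    ∑ i ∈ Finset.range n, (ω i : ℝ) / denom q (i + 1)) (fun n => ?_)
    (ae_lt.mono fun ω hω => (hasSum_cantorSum hω).tendsto_sum_nat)
  refine Measurable.aemeasurable (Finset.measurable_fun_sum _ fun i _ => Measurable.div_const ?_ _)
  exact measurable_from_nat.comp (measurable_pi_apply i)

theorem digitMeasure_box_range_le (h2 : ∀ n, 2 * a n ≤ q n) (n : ℕ) (e : ℕ → ℕ) :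
    digitMeasure haq (box (Finset.range n) e) ≤ ENNReal.ofReal (2 ^ n / denom q n) := by
  rw [← ofReal_measureReal, digitMeasure_real_box]
  refine ENNReal.ofReal_le_ofReal ?_
  rw [denom, ← Finset.card_range n, ← Finset.prod_const, Finset.card_range, ← Finset.prod_div_distrib]
  refine Finset.prod_le_prod (fun i _ => by positivity) fun i _ => ?_
  have hq : (0 : ℝ) < q i := by exact_mod_cast (Nat.zero_le _).trans_lt (haq i)
  split_ifs
  · have h3 : (q i : ℝ) ≤ 2 * (q i - a i : ℕ) := by
      have h4 := h2 i
      exact_mod_cast (show q i ≤ 2 * (q i - a i) by omega)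
    rw [inv_eq_one_div, div_le_div_iff₀ (by linarith) hq]
    linarith
  · positivity

theorem digitMeasure_prefixNum_le (h2 : ∀ n, 2 * a n ≤ q n) (n p : ℕ) :
    digitMeasure haq {ω | (∀ i, ω i < q i) ∧ prefixNum q ω n = p} ≤
      ENNReal.ofReal (2 ^ n / denom q n) := by
  rcases Set.eq_empty_or_nonempty {ω : ℕ → ℕ | (∀ i, ω i < q i) ∧ prefixNum q ω n = p} with h | h
  · rw [h, measure_empty]
    exact zero_le
  · obtain ⟨ω₀, h₀, hp⟩ := h
    refine le_trans (measure_mono ?_) (digitMeasure_box_range_le h2 n ω₀)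
    rintro ω ⟨hω, hωp⟩ i hi
    exact eq_of_prefixNum_eq hω h₀ (hωp.trans hp.symm) i (Finset.mem_range.mp hi)

/-- Points within `r` of each other have level-`n` prefix numbers that differ by at most `r * denom
q n + 1`, so few cylinders meet `T`. -/
theorem digitMeasure_preimage_le (h2 : ∀ n, 2 * a n ≤ q n) {T : Set ℝ} {r : ℝ} (hr : 0 ≤ r)
    (hT : ∀ x ∈ T, ∀ y ∈ T, x - y ≤ r) (n : ℕ) :
    digitMeasure haq (cantorSum q ⁻¹' T) ≤
      ENNReal.ofReal ((2 * r * denom q n + 3) * (2 ^ n / denom q n)) := by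
  have hD : 0 < denom q n := denom_pos (fun i => (Nat.zero_le _).trans_lt (haq i)) n
  have hG : digitMeasure haq (cantorSum q ⁻¹' T) ≤
      digitMeasure haq {ω | (∀ i, ω i < q i) ∧ cantorSum q ω ∈ T} :=
    measure_mono_ae (ae_lt.mono fun ω hω h => ⟨hω, h⟩)
  refine hG.trans ?_
  rcases Set.eq_empty_or_nonempty {ω : ℕ → ℕ | (∀ i, ω i < q i) ∧ cantorSum q ω ∈ T} with h | h
  · rw [h, measure_empty]
    exact zero_le
  obtain ⟨ω₀, h₀, hT₀⟩ := h
  set K := ⌊r * denom q n + 1⌋₊ with hK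
  set p₀ := prefixNum q ω₀ n with hp₀
  have hsub : {ω : ℕ → ℕ | (∀ i, ω i < q i) ∧ cantorSum q ω ∈ T} ⊆
      ⋃ p ∈ Finset.Icc (p₀ - K) (p₀ + K), {ω | (∀ i, ω i < q i) ∧ prefixNum q ω n = p} := by
    rintro ω ⟨hω, hωT⟩
    simp only [Set.mem_iUnion]
    refine ⟨prefixNum q ω n, ?_, hω, rfl⟩
    have h3 := prefixNum_le hω (hasSum_cantorSum hω) n
    have h4 := le_prefixNum_add_one hω (hasSum_cantorSum hω) n
    have h5 := prefixNum_le h₀ (hasSum_cantorSum h₀) n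
    have h6 := le_prefixNum_add_one h₀ (hasSum_cantorSum h₀) n
    have h7 := mul_le_mul_of_nonneg_right (hT _ hωT _ hT₀) hD.le
    have h8 := mul_le_mul_of_nonneg_right (hT _ hT₀ _ hωT) hD.le
    have h9 : prefixNum q ω n - p₀ ≤ K := Nat.le_floor <| by
      rcases le_total p₀ (prefixNum q ω n) with h | h
      · rw [Nat.cast_sub h]
        linarith
      · rw [Nat.sub_eq_zero_of_le h, Nat.cast_zero]
        positivity
    have h10 : p₀ - prefixNum q ω n ≤ K := Nat.le_floor <| by
      rcases le_total (prefixNum q ω n) p₀ with h | h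
      · rw [Nat.cast_sub h]
        linarith
      · rw [Nat.sub_eq_zero_of_le h, Nat.cast_zero]
        positivity
    rw [Finset.mem_Icc]
    omega
  refine (measure_mono hsub).trans ((measure_biUnion_finset_le _ _).trans ?_)
  refine (Finset.sum_le_sum fun p _ => digitMeasure_prefixNum_le h2 n p).trans ?_
  rw [Finset.sum_const, nsmul_eq_mul, ← ENNReal.ofReal_natCast,
    ← ENNReal.ofReal_mul (Nat.cast_nonneg _)]
  refine ENNReal.ofReal_le_ofReal (mul_le_mul_of_nonneg_right ?_ (by positivity))
  have h3 : (Finset.Icc (p₀ - K) (p₀ + K)).card ≤ 2 * K + 1 := by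
    rw [Nat.card_Icc]
    omega
  have h4 : (K : ℝ) ≤ r * denom q n + 1 := Nat.floor_le (by positivity)
  have h5 : ((Finset.Icc (p₀ - K) (p₀ + K)).card : ℝ) ≤ 2 * K + 1 := by exact_mod_cast h3
  linarith

theorem one_le_denom (hq : ∀ n, 0 < q n) (n : ℕ) : 1 ≤ denom q n :=
  Finset.one_le_prod fun i _ => by exact_mod_cast hq i

/-- From some `N` on each factor `q n ^ ε` is at least `2`; the constant `2 ^ N` pays for the places
before. -/
theorem exists_two_pow_le_rpow_denom (hq : ∀ n, 0 < q n) (hlim : Tendsto q atTop atTop) {ε : ℝ}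
    (hε : 0 < ε) : ∃ C > 0, ∀ n, (2 : ℝ) ^ n ≤ C * denom q n ^ ε := by
  have h1 : Tendsto (fun n => (q n : ℝ) ^ ε) atTop atTop :=
    (tendsto_rpow_atTop hε).comp (tendsto_natCast_atTop_atTop.comp hlim)
  obtain ⟨N, hN⟩ := eventually_atTop.mp (h1.eventually_ge_atTop 2)
  refine ⟨2 ^ N, by positivity, fun n => ?_⟩
  rcases le_total n N with hn | hn
  · calc (2 : ℝ) ^ n ≤ 2 ^ N := pow_le_pow_right₀ one_le_two hn
      _ ≤ _ := le_mul_of_one_le_right (by positivity)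
          (Real.one_le_rpow (one_le_denom hq n) hε.le)
  · induction n, hn using Nat.le_induction with
    | base =>
      exact le_mul_of_one_le_right (by positivity)
        (Real.one_le_rpow (one_le_denom hq N) hε.le)
    | succ n hn ih =>
      rw [denom_succ, Real.mul_rpow (denom_pos hq n).le (Nat.cast_nonneg _), pow_succ, ← mul_assoc]
      exact mul_le_mul ih (hN n hn) zero_le_two
        (mul_nonneg (by positivity) (Real.rpow_nonneg (denom_pos hq n).le _))

theorem tendsto_denom_atTop (hq : ∀ n, 2 ≤ q n) : Tendsto (denom q) atTop atTop := by
  refine tendsto_atTop_mono (fun n => ?_) (tendsto_pow_atTop_atTop_of_one_lt (one_lt_two (α := ℝ)))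
  calc (2 : ℝ) ^ n = ∏ _i ∈ Finset.range n, (2 : ℝ) := by simp
    _ ≤ denom q n := Finset.prod_le_prod (fun _ _ => zero_le_two) fun i _ => by exact_mod_cast hq i

theorem exists_digitMeasure_preimage_le_rpow (hq : ∀ n, 2 ≤ q n) (hlim : Tendsto q atTop atTop)
    (h2 : ∀ n, 2 * a n ≤ q n) {d : ℝ} (hd : d < 1) :
    ∃ C > 0, ∀ (T : Set ℝ) (r : ℝ), 0 < r → r ≤ 1 → (∀ x ∈ T, ∀ y ∈ T, x - y ≤ r) →
      digitMeasure haq (cantorSum q ⁻¹' T) ≤ ENNReal.ofReal (C * r ^ d) := by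
  have hq0 : ∀ n, 0 < q n := fun n => Nat.zero_lt_two.trans_le (hq n)
  obtain ⟨C, hC, hpow⟩ := exists_two_pow_le_rpow_denom hq0 hlim (sub_pos.mpr hd)
  refine ⟨10 * C, by positivity, fun T r hr hr1 hT => ?_⟩
  -- Take the first level finer than `r`. There the count of cylinders is at most `5 * r * denom q
  -- (n + 1)`, so the possibly huge last base cancels and `10 * r * 2 ^ n` remains, with `denom q n
  -- ≤ 1 / r`.
  have hex : ∃ n, 1 / r < denom q n := ((tendsto_denom_atTop hq).eventually_gt_atTop _).exists
  classical
  rcases hn : Nat.find hex with _ | n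
  · have h0 : 1 / r < denom q 0 := hn ▸ Nat.find_spec hex
    simp only [denom, Finset.range_zero, Finset.prod_empty] at h0
    exact absurd h0 (not_lt.mpr (one_le_one_div hr hr1))
  have h1 : 1 / r < denom q (n + 1) := hn ▸ Nat.find_spec hex
  have h3 : denom q n ≤ 1 / r := not_lt.mp (Nat.find_min hex (by omega))
  refine (digitMeasure_preimage_le h2 hr.le hT (n + 1)).trans (ENNReal.ofReal_le_ofReal ?_)
  have hD := denom_pos hq0 (n + 1)
  have h4 : 1 ≤ r * denom q (n + 1) := by
    rw [div_lt_iff₀ hr] at h1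
    linarith
  calc _ ≤ (5 * (r * denom q (n + 1))) * (2 ^ (n + 1) / denom q (n + 1)) :=
        mul_le_mul_of_nonneg_right (by linarith) (by positivity)
    _ = 10 * r * 2 ^ n := by
        field_simp
        ring
    _ ≤ 10 * r * (C * (1 / r) ^ (1 - d)) := by
        refine mul_le_mul_of_nonneg_left ((hpow n).trans ?_) (by positivity)
        exact mul_le_mul_of_nonneg_left (Real.rpow_le_rpow (denom_pos hq0 n).le h3
          (sub_pos.mpr hd).le) hC.le
    _ = 10 * C * r ^ d := by
        rw [one_div, Real.inv_rpow hr.le, ← Real.rpow_neg hr.le,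
          show d = 1 + -(1 - d) by ring, Real.rpow_add hr, Real.rpow_one]
        ring_nf

/-- The mass distribution principle for the digit measures: a set of full measure has dimension
`1`. -/
theorem one_le_dimH (hq : ∀ n, 2 ≤ q n) (hlim : Tendsto q atTop atTop)
    (h2 : ∀ n, 2 * a n ≤ q n) {A : Set ℝ}
    (hA : ∀ᵐ ω ∂digitMeasure haq, cantorSum q ω ∈ A) : 1 ≤ dimH A := by
  refine ENNReal.le_of_forall_nnreal_lt fun d hd1 => ?_
  have hd : (d : ℝ) < 1 := by exact_mod_cast hd1
  rcases eq_zero_or_pos d with rfl | hd0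
  · exact zero_le
  have hd0' : (0 : ℝ) < d := hd0
  obtain ⟨C, hC, hbound⟩ := exists_digitMeasure_preimage_le_rpow (haq := haq) hq hlim h2 hd
  have hC0 : ENNReal.ofReal C ≠ 0 := by simpa using hC
  set ν := (digitMeasure haq).map (cantorSum q) with hν
  have hclosed : ∀ T : Set ℝ, IsClosed T → ν T = digitMeasure haq (cantorSum q ⁻¹' T) :=
    fun T hT => Measure.map_apply_of_aemeasurable aemeasurable_cantorSum hT.measurableSet
  have hle : (ENNReal.ofReal C)⁻¹ • ν ≤ μH[(d : ℝ)] := by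
    refine Measure.le_hausdorffMeasure d _ (ENNReal.ofReal (1 / 2)) (by simp) fun T hT => ?_
    have hfin : Metric.ediam T ≠ ⊤ := ne_top_of_le_ne_top ENNReal.ofReal_ne_top hT
    rw [Measure.smul_apply, smul_eq_mul, ENNReal.inv_mul_le_iff hC0 ENNReal.ofReal_ne_top]
    have hdiam : Metric.diam T ≤ 1 / 2 := by
      rw [Metric.diam]
      exact ENNReal.toReal_le_of_le_ofReal (by norm_num) hT
    have hr : ∀ r, Metric.diam T < r → r ≤ 1 → ν T ≤ ENNReal.ofReal (C * r ^ (d : ℝ)) := by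
      intro r hr hr1
      -- `T` is arbitrary; its closure is measurable and has the same diameter.
      refine (measure_mono subset_closure).trans ((hclosed _ isClosed_closure).trans_le ?_)
      refine hbound _ r (Metric.diam_nonneg.trans_lt hr) hr1 fun x hx y hy => ?_
      refine (le_abs_self _).trans (le_trans ?_ hr.le)
      rw [← Real.dist_eq, ← Metric.diam_closure]
      refine Metric.dist_le_diam_of_mem' ?_ hx hy
      rwa [Metric.ediam_closure]
    -- The bound holds for radii above the diameter, which may be `0`; letting them decrease to it
    -- gives the bound at the diameter.
    have hlimr : Tendsto (fun r => ENNReal.ofReal (C * r ^ (d : ℝ))) (𝓝[>] Metric.diam T)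
        (𝓝 (ENNReal.ofReal (C * Metric.diam T ^ (d : ℝ)))) := by
      refine (ENNReal.continuous_ofReal.tendsto _).comp (Tendsto.const_mul _ ?_)
      exact (Real.continuousAt_rpow_const _ _ (Or.inr hd0'.le)).tendsto.mono_left
        nhdsWithin_le_nhds
    have h3 : ν T ≤ ENNReal.ofReal (C * Metric.diam T ^ (d : ℝ)) := by
      refine ge_of_tendsto hlimr ?_
      filter_upwards [self_mem_nhdsWithin,
        mem_nhdsWithin_of_mem_nhds (Iio_mem_nhds (show Metric.diam T < 1 by linarith))]
        with r h4 h5 using hr r h4 (le_of_lt h5)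
    rwa [ENNReal.ofReal_mul hC.le, ← ENNReal.ofReal_rpow_of_nonneg Metric.diam_nonneg hd0'.le,
      Metric.diam, ENNReal.ofReal_toReal hfin] at h3
  refine le_dimH_of_hausdorffMeasure_ne_zero fun h0 => ?_
  have h1 := le_antisymm ((hle A).trans_eq h0) zero_le
  rw [Measure.smul_apply, smul_eq_mul, mul_eq_zero, ENNReal.inv_eq_zero] at h1
  have h3 := h1.resolve_left ENNReal.ofReal_ne_top
  -- This inequality for pushforwards needs no measurability of `A`.
  have h4 := le_antisymm ((Measure.le_map_apply aemeasurable_cantorSum A).trans_eq h3) zero_le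
  have h5 : digitMeasure haq Set.univ ≤ digitMeasure haq (cantorSum q ⁻¹' A) :=
    measure_mono_ae (hA.mono fun ω hω _ => hω)
  rw [h4, measure_univ] at h5
  exact absurd h5 (by simp)

end Dimension

/-! ### From block counts to normality -/

section Normality

variable {q ω : ℕ → ℕ}

theorem frequently_of_tendsto_blockCount {k : ℕ} {B : Fin k → ℕ}
    (h : Tendsto (blockCount ω B) atTop atTop) : ∃ᶠ n in atTop, ∀ i : Fin k, ω (n + i) = B i := by
  intro hev
  obtain ⟨N, hN⟩ := eventually_atTop.mp hev
  obtain ⟨n, hn⟩ := (h.eventually_gt_atTop N).exists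
  refine absurd hn (not_lt.mpr ?_)
  rw [← Finset.card_range N]
  refine Finset.card_le_card fun j hj => Finset.mem_range.mpr ?_
  by_contra hjN
  exact hN j (not_lt.mp hjN) (Finset.mem_filter.mp hj).2

theorem tendsto_blockCount_atTop {k : ℕ} {B : Fin k → ℕ} {A : ℕ → ℝ} (hA : Tendsto A atTop atTop)
    (h : Tendsto (fun n => (blockCount ω B n : ℝ) / A n) atTop (𝓝 1)) :
    Tendsto (blockCount ω B) atTop atTop := by
  refine tendsto_natCast_atTop_iff.mp ((h.pos_mul_atTop one_pos hA).congr' ?_)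
  filter_upwards [hA.eventually_gt_atTop 0] with n hn
  exact div_mul_cancel₀ _ hn.ne'

/-- Digits whose block counts are asymptotic to sums `A k` comparable with the expected counts
exactly for `k ≥ ℓ` are those of a number that is normal of the orders `k ≥ ℓ` only. -/
theorem cantorSum_mem {ℓ : ℕ} (hq : ∀ n, 2 ≤ q n) {A : ℕ → ℕ → ℝ} (hω : ∀ n, ω n < q n)
    (hA : ∀ k, 1 ≤ k → Tendsto (A k) atTop atTop)
    (hcount : ∀ k, 1 ≤ k → ∀ B : Fin k → ℕ,
      Tendsto (fun n => (blockCount ω B n : ℝ) / A k n) atTop (𝓝 1)) (hℓ : 1 ≤ ℓ)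
    (hge : ∀ k, ℓ ≤ k → Tendsto (fun n => A k n / expectedCount q k n) atTop (𝓝 1))
    (hlt : ∀ k, 1 ≤ k → k < ℓ →
      ¬ Tendsto (fun n => A k n / expectedCount q k n) atTop (𝓝 1)) :
    cantorSum q ω ∈ (⋂ j ∈ Set.Ici ℓ, normalOfOrder q j) \ ⋃ j ∈ Set.Ico 1 ℓ, normalOfOrder q j := by
  -- The digit `0` recurs infinitely often and is never maximal, since `q n ≥ 2`.
  have hfreq : ∃ᶠ n in atTop, ω n + 1 ≠ q n := by
    have h1 := frequently_of_tendsto_blockCount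
      (tendsto_blockCount_atTop (hA 1 le_rfl) (hcount 1 le_rfl fun _ => 0))
    refine h1.mono fun n hn => ?_
    have h2 : ω n = 0 := by simpa using hn
    have h3 := hq n
    omega
  have hexp : IsExpansion q (cantorSum q ω) ω :=
    isExpansion_of_hasSum hω hfreq (hasSum_cantorSum hω)
  constructor
  · refine Set.mem_iInter₂.mpr fun k hk => ⟨ω, hexp, fun B => ?_⟩
    have h1 := (hcount k (hℓ.trans hk) B).mul (hge k hk)
    rw [mul_one] at h1
    refine h1.congr' ?_
    filter_upwards [(hA k (hℓ.trans hk)).eventually_gt_atTop 0] with n hn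
    exact div_mul_div_cancel₀ hn.ne'
  · simp only [Set.mem_iUnion, not_exists]
    rintro k ⟨hk1, hkℓ⟩ ⟨E, hE, hEB⟩
    obtain rfl := hE.unique hexp
    refine hlt k hk1 hkℓ ?_
    -- One block suffices: the count of the zero block would be asymptotic both to the expected
    -- count and to `A k`, so these would be asymptotic to each other.
    have h1 := (hEB fun _ => 0).div (hcount k hk1 fun _ => 0) one_ne_zero
    rw [div_one] at h1
    have hpos := (tendsto_blockCount_atTop (hA k hk1) (hcount k hk1 fun _ => 0)).eventually_gt_atTop 0
    refine h1.congr' ?_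
    filter_upwards [(hA k hk1).eventually_gt_atTop 0, hpos] with n hn hn'
    have hn'' : (blockCount E (fun _ : Fin k => 0) n : ℝ) ≠ 0 := Nat.cast_ne_zero.mpr hn'.ne'
    rw [Pi.div_apply, div_div_div_comm, div_self hn'', one_div_div]

end Normality

end CantorSeries

/-! ### Assembly of the main theorem -/

theorem mainTheorem5 (α β s t υ : ℕ → ℕ) (ℓ : ℕ) (hℓ : 1 ≤ ℓ)
    (hα : CantorSeries.IsBasic α) (hβ : CantorSeries.IsBasic β)
    (hlim : CantorSeries.InfiniteInLimit (CantorSeries.blockSeq α β s t υ))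
    (hdiv : CantorSeries.FullyDivergent (CantorSeries.blockSeq α β s t υ))
    (hHDT1 : CantorSeries.HDT1 α β s t υ)
    (hHDT2 : CantorSeries.HDT2 α β s t)
    (hNQ : ∀ k, ℓ ≤ k → CantorSeries.NQ α β s t k)
    (hNotNQ : ∀ k, 1 ≤ k → k < ℓ → CantorSeries.NotNQ α β s t k)
    (hRNQ : ∀ k, 1 ≤ k → CantorSeries.RNQ α s k) :
    dimH ((⋂ j ∈ Set.Ici ℓ, CantorSeries.normalOfOrder (CantorSeries.blockSeq α β s t υ) j) \
      ⋃ j ∈ Set.Ico 1 ℓ, CantorSeries.normalOfOrder (CantorSeries.blockSeq α β s t υ) j) = 1 := by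
  open CantorSeries MeasureTheory in
  refine le_antisymm ((dimH_mono (Set.subset_univ _)).trans_eq Real.dimH_univ) ?_
  set q := blockSeq α β s t υ with hqdef
  set A : ℕ → ℕ → ℝ := fun k n => ∑ j ∈ Finset.range n, freeWeight (lowDigit β s t υ) q k j
    with hAdef
  have hq : ∀ n, 2 ≤ q n := two_le_blockSeq hα hβ
  have hge : ∀ k, ℓ ≤ k → Tendsto (fun n => A k n / expectedCount q k n) atTop (𝓝 1) :=
    fun k hk => tendsto_sum_freeWeight_div hα hβ hlim (hdiv k (hℓ.trans hk)) (hNQ k hk)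
      (hRNQ k (hℓ.trans hk))
  have hAge : ∀ k, ℓ ≤ k → Tendsto (A k) atTop atTop := fun k hk => by
    refine ((hge k hk).pos_mul_atTop one_pos (hdiv k (hℓ.trans hk))).congr' ?_
    filter_upwards [(hdiv k (hℓ.trans hk)).eventually_gt_atTop 0] with n hn
    exact div_mul_cancel₀ _ hn.ne'
  -- For `k < ℓ` the free sum is not asymptotic to the expected count, so its divergence is taken
  -- from the order `max k ℓ`.
  have hA : ∀ k, 1 ≤ k → Tendsto (A k) atTop atTop := fun k _ =>
    tendsto_atTop_mono (fun n => Finset.sum_le_sum fun j _ => freeWeight_anti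
      (fun n => Nat.zero_lt_two.trans_le (hq n)) (le_max_left k ℓ) j)
      (hAge (max k ℓ) (le_max_right k ℓ))
  have haq : ∀ n, lowDigit β s t υ n < q n := lowDigit_lt hα hβ
  have hcount : ∀ᵐ ω ∂digitMeasure haq, ∀ k, 1 ≤ k →
      ∀ B : Fin k → ℕ, Tendsto (fun n => (blockCount ω B n : ℝ) / A k n) atTop (𝓝 1) :=
    ae_all_iff.mpr fun k => eventually_imp_distrib_left.mpr fun hk =>
      ae_tendsto_blockCount_div hlim (eventually_lowDigit hlim) k (hA k hk)
  refine one_le_dimH (haq := haq) hq hlim two_mul_lowDigit_le ?_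
  filter_upwards [ae_lt, hcount] with ω hω hωc
  exact cantorSum_mem hq hω hA hωc hℓ hge fun k hk hkℓ =>
    not_tendsto_sum_freeWeight_div hα hβ hk hlim (hdiv k hk) (hNotNQ k hk hkℓ) (hRNQ k hk)
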